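/- **Setting.** For every value $\lambda\in\mathbb N$ of the security parameter there are $n=3f+1$ validators; up to $f$ of them, chosen adaptively, are Byzantine, and *correct* means never corrupted. Time is discrete (ticks) and local computation takes no time, except that a validator advances at most one round per tick. After an unknown global stabilization time GST the delay bound $\Delta\ge 1$ (ticks) holds. All parameters $f$, the sample size $D\ge1$, the timeout $T$, and an upper bound on GST are polynomially bounded in $\lambda$, and $T\ge 2\Delta$. "Exponentially small" means at most $C e^{-c\lambda}$ for all $\lambda$, with constants $C$ and $c>0$; "with high probability" means except with exponentially small probability. **Building blocks.** (a) *Byzantine reliable broadcast*: for each sender and sequence number at most one message is ever certified; correct validators deliver only certified messages, each at most once; what is delivered from a correct sender was broadcast by it at an earlier tick; a message broadcast by a correct validator, or delivered by some correct validator, at tick $t$ is delivered by every correct validator by tick $\max(t,\mathrm{GST})+\Delta$. A certified message comes with a certificate; a certified reference is a vertex together with its certificate. (b) *Seeded ALBA* with parameters $n_p=2f+1$, $n_f=f$, sample size $D$: deterministic procedures $\mathrm{Prove}(seed,S)$, which for $|S|\ge n_p$ returns a list of $D$ elements of $S$, and $\mathrm{Verify}(seed,sample)$, which accepts only lists of length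 $D$. For a random seed and a fixed set $S$, $|S|\ge n_p$, the sample $\mathrm{Prove}(seed,S)$ is rejected with probability at most $\varepsilon(\lambda)$; for a fixed set $F$, $|F|\le n_f$, some sample with elements in $F$ is accepted with probability at most $\varepsilon(\lambda)$; $\varepsilon$ is exponentially small. (c) *A vector commitment* for arrays of $n$ entries (each a certified reference or $\bot$), with correct openings. (d) *A hash function* from commitments to ALBA seeds, modelled as a lazily sampled random oracle: the value at a commitment that is hashed for the first time is a fresh seed, independent of all that is known before. *Computational boundedness:* all parties and the adversary together make at most $p(\lambda+t)$ evaluations up to tick $t$, for a polynomial $p$ (correct validators hash when they create or validate a vertex). To the first evaluation at a commitment one attaches the array of certified references to which the evaluating party can open it, known at that time. *Binding:* for every polynomially bounded horizon, with high probability every array to which a correct validator commits, and every sampled reference opened by a vertex in the DAG of a correct validator, agrees with the array attached to the first evaluation at that commitment. **Sparse Bullshark.** Each validator $p_i$ ($0\le i<n$) keeps a DAG of vertices, initially consisting of $n$ hard-coded vertices of round $0$, a current round, initially $0$, and a FIFO queue of blocks; correct validators always have a block in the queue. The anchor of an even round $r$ is its vertex with source $(r/2)\bmod n$. *Creation.*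 $p_i$ advances from round $r$ to $r+1$ when its DAG has at least $2f+1$ vertices of round $r$, and either $T$ ticks have passed since it entered round $r$; or $r$ is even and its DAG contains the anchor of round $r$; or $r$ is odd and at least $2f+1$ of the round-$r$ vertices in its DAG reference the anchor of round $r-1$ or at least $f+1$ of them do not. It then reliably broadcasts a vertex of round $r+1$ with the next block of the queue. To create it, it commits to the array $S$ (indexed by source) of the certified references of the round-$r$ vertices in its DAG, with commitment $c$, draws the sample $\mathrm{Prove}(\mathrm{Hash}(c),S)$, and takes as edges the sampled vertices, its own round-$r$ vertex, and the anchor of round $r$ if that is in its DAG; $c$ and openings for the sampled entries are attached. *Validation.* A delivered vertex is accepted if its source and round match the broadcast, it has at most $D+2$ edges, all to the previous round, all openings of the sampled entries verify, and ALBA accepts the sample with seed $\mathrm{Hash}(c)$. It enters the DAG once all its parents are in the DAG. *Ordering.* When a vertex of round $r+1$ enters the DAG and at least $2f+1$ round-$(r+1)$ vertices there reference the anchor $v$ of round $r$, and $r$ exceeds the round of the last directly committed anchor, then $v$ is committed: going back from $v$ round by round to the last directly committed anchor, every earlier anchor with a path from the current one is put on a stack and becomes the current one; then for every anchor on the stack,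 earliest round first, all vertices of rounds $\ge1$ reachable from it and not yet ordered are ordered in a deterministic order. Ordering the vertex with source $p_k$, round $s$ and block $m$ is the event $a\_deliver(m,s,p_k)$. Invoking $a\_bcast(m,s)$ puts $m$, the $s$-th message of the validator ($s=1,2,\dots$), into its queue. **Theorem.** Sparse Bullshark satisfies Agreement and Validity of Byzantine atomic broadcast with high probability, in executions of polynomial length. That is, for every polynomially bounded $\tau$: * (Agreement) except with exponentially small probability, every $(m,s,p_k)$ that some correct validator $a\_delivers$ before tick $\tau(\lambda)$ is eventually $a\_delivered$ by every correct validator; * (Validity) except with exponentially small probability, for every correct validator $p_k$ and every $s\le\tau(\lambda)$, if $p_k$ invokes $a\_bcast(m,s)$, then eventually $p_k$ outputs $a\_deliver(m,s,p_k)$. -/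

import Mathlib

open MeasureTheory
open scoped ENNReal

namespace SparseBullshark

/-! ### Asymptotics in the security parameter -/

/-- Polynomially bounded in the security parameter. -/
def PolyBounded (g : ℕ → ℕ) : Prop :=
  ∃ p : Polynomial ℕ, ∀ sec, g sec ≤ p.eval sec

/-- Exponentially small in the security parameter. -/
def ExpSmall (δ : ℕ → ℝ≥0∞) : Prop :=
  ∃ C c : ℝ, 0 < c ∧ ∀ sec : ℕ, δ sec ≤ ENNReal.ofReal (C * Real.exp (-c * sec))

/-! ### Cryptographic building blocks -/

/-- A vector commitment scheme for vectors of length `n`: commitments `C`, opening proofs `O`. -/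
structure VectorCommitment (n : ℕ) (A C O : Type) where
  commit : (Fin n → A) → C
  proof : (Fin n → A) → Fin n → O
  verify : C → Fin n → A → O → Bool
  correct : ∀ a i, verify (commit a) i (a i) (proof a i) = true

/-- A seeded approximate lower bound argument with parameters `np`, `nf`, sample size `D` and error
`ε`: for a seed drawn from `ν`, the honest sample of any fixed set of at least `np` elements is
accepted, and no sample from a fixed set of at most `nf` elements is accepted, each except with
probability `ε`. -/
structure ALBA {Seed : Type} [MeasurableSpace Seed] (ν : Measure Seed) (E : Type)
    (np nf D : ℕ) (ε : ℝ≥0∞) where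
  prove : Seed → Finset E → List E
  verify : Seed → List E → Bool
  prove_length : ∀ s S, np ≤ S.card → (prove s S).length = D
  prove_mem : ∀ s S, np ≤ S.card → ∀ x ∈ prove s S, x ∈ S
  verify_length : ∀ s l, verify s l = true → l.length = D
  completeness : ∀ S : Finset E, np ≤ S.card → ν {s | verify s (prove s S) = false} ≤ ε
  soundness : ∀ F : Finset E, F.card ≤ nf →
    ν {s | ∃ l : List E, (∀ x ∈ l, x ∈ F) ∧ verify s l = true} ≤ ε

/-! ### Vertices of the DAG -/

/-- The countable sets of blocks (messages), commitments, opening proofs and reliable-broadcast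
certificates. -/
structure Alphabet where
  Block : Type
  Comm : Type
  Opening : Type
  Cert : Type
  countable_block : Countable Block
  countable_comm : Countable Comm
  countable_opening : Countable Opening
  countable_cert : Countable Cert

/-- Vertices: the `n` hard-coded vertices of round `0`, and the vertices created by the protocol.
The edges are the sampled vertices `sample` together with `links` (predecessor of the same
validator, previous anchor); the sampling proof is the commitment `comm` with one opening per
sampled vertex. -/
inductive Vertex (𝕋 : Alphabet) (n : ℕ) : Type
  | genesis (source : Fin n) : Vertex 𝕋 n
  | node (round : ℕ) (source : Fin n) (block : 𝕋.Block) (sample links : List (Vertex 𝕋 n))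
      (comm : 𝕋.Comm) (openings : List 𝕋.Opening) : Vertex 𝕋 n

namespace Vertex

variable {𝕋 : Alphabet} {n : ℕ}

def round : Vertex 𝕋 n → ℕ
  | genesis _ => 0
  | node r _ _ _ _ _ _ => r

def source : Vertex 𝕋 n → Fin n
  | genesis i => i
  | node _ i _ _ _ _ _ => i

def block : Vertex 𝕋 n → Option 𝕋.Block
  | genesis _ => none
  | node _ _ b _ _ _ _ => some b

def sample : Vertex 𝕋 n → List (Vertex 𝕋 n)
  | genesis _ => []
  | node _ _ _ s _ _ _ => s

def edges : Vertex 𝕋 n → List (Vertex 𝕋 n)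
  | genesis _ => []
  | node _ _ _ s l _ _ => s ++ l

def comm : Vertex 𝕋 n → Option 𝕋.Comm
  | genesis _ => none
  | node _ _ _ _ _ c _ => some c

end Vertex

/-- A certified reference: a vertex with its reliable-broadcast certificate. -/
abbrev Ref (𝕋 : Alphabet) (n : ℕ) : Type := Vertex 𝕋 n × 𝕋.Cert

/-- The parameters of Sparse Bullshark for one value of the security parameter: `3 f + 1` validators,
sample size `D`, the timeout (in ticks), a vector commitment to arrays of certified references, and
an ALBA with `n_p = 2 f + 1`, `n_f = f`. -/
structure Protocol (𝕋 : Alphabet) where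
  f : ℕ
  D : ℕ
  one_le_D : 1 ≤ D
  timeout : ℕ
  vc : VectorCommitment (3 * f + 1) (Option (Ref 𝕋 (3 * f + 1))) 𝕋.Comm 𝕋.Opening
  Seed : Type
  seedSpace : MeasurableSpace Seed
  seedLaw : Measure Seed
  seedLaw_prob : IsProbabilityMeasure seedLaw
  albaError : ℝ≥0∞
  alba : ALBA seedLaw (Ref 𝕋 (3 * f + 1)) (2 * f + 1) f D albaError

attribute [instance] Protocol.seedSpace Protocol.seedLaw_prob

namespace Protocol

variable {𝕋 : Alphabet} (P : Protocol 𝕋)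

/-- The number of validators. -/
abbrev n : ℕ := 3 * P.f + 1

/-- The leader of the (even) round `r`: round robin. -/
def leader (r : ℕ) : Fin P.n := ⟨(r / 2) % P.n, Nat.mod_lt _ (Nat.succ_pos _)⟩

/-- The local state of a validator. `timer` is the tick of the last timer reset, `own` the last
vertex created by the validator, `ordered` the sequence of vertices ordered (delivered) so far. -/
structure State where
  buffer : List (Vertex 𝕋 P.n)
  dag : Finset (Vertex 𝕋 P.n)
  round : ℕ
  timer : ℕ
  queue : List 𝕋.Block
  own : Vertex 𝕋 P.n
  lastOrdered : ℕ
  ordered : List (Vertex 𝕋 P.n)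

open Classical in
/-- Initial state of validator `i`: the DAG consists of the vertices of round `0`. -/
noncomputable def init (i : Fin P.n) : P.State where
  buffer := []
  dag := Finset.univ.image Vertex.genesis
  round := 0
  timer := 0
  queue := []
  own := Vertex.genesis i
  lastOrdered := 0
  ordered := []

/-! #### Basic utilities -/

/-- `PathExists(v, u)`. -/
def PathExists (dag : Finset (Vertex 𝕋 P.n)) (v u : Vertex 𝕋 P.n) : Prop :=
  Relation.ReflTransGen (fun a b => b ∈ a.edges ∧ b ∈ dag ∧ 1 ≤ b.round) v u

open Classical in
/-- The vertex of round `r` and source `i` in the DAG, if there is one. -/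
noncomputable def lookup (dag : Finset (Vertex 𝕋 P.n)) (r : ℕ) (i : Fin P.n) :
    Option (Vertex 𝕋 P.n) :=
  if h : ∃ v ∈ dag, v.round = r ∧ v.source = i then some h.choose else none

/-- `GetAnchor(r)`. -/
noncomputable def getAnchor (dag : Finset (Vertex 𝕋 P.n)) (r : ℕ) : Option (Vertex 𝕋 P.n) :=
  if r % 2 = 1 then none else P.lookup dag r (P.leader r)

open Classical in
/-- `DAG[r]`. -/
noncomputable def layer (dag : Finset (Vertex 𝕋 P.n)) (r : ℕ) : Finset (Vertex 𝕋 P.n) :=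
  dag.filter (fun v => v.round = r)

open Classical in
/-- `MayAdvanceRound` at tick `now`. -/
noncomputable def MayAdvance (s : P.State) (now : ℕ) : Prop :=
  2 * P.f + 1 ≤ (P.layer s.dag s.round).card ∧
    (s.timer + P.timeout ≤ now ∨
      if s.round % 2 = 0 then (P.getAnchor s.dag s.round).isSome = true
      else
        2 * P.f + 1 ≤ ((P.layer s.dag s.round).filter
          (fun v => ∃ a ∈ P.getAnchor s.dag (s.round - 1), a ∈ v.edges)).card ∨
        P.f + 1 ≤ ((P.layer s.dag s.round).filter
          (fun v => ¬ ∃ a ∈ P.getAnchor s.dag (s.round - 1), a ∈ v.edges)).card)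

/-! #### Ordering -/

open Classical in
/-- The loop of `OrderAnchors`, from round `r` downwards; returns the stack (top first). -/
noncomputable def anchorStack (dag : Finset (Vertex 𝕋 P.n)) (last : ℕ) :
    ℕ → Vertex 𝕋 P.n → List (Vertex 𝕋 P.n) → List (Vertex 𝕋 P.n)
  | 0, _, stack => stack
  | 1, _, stack => stack
  | r + 2, anchor, stack =>
    if last < r + 2 then
      match P.getAnchor dag (r + 2) with
      | some prev =>
        if P.PathExists dag anchor prev then anchorStack dag last r prev (prev :: stack)
        else anchorStack dag last r anchor stack
      | none => anchorStack dag last r anchor stack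
    else stack

open Classical in
/-- One iteration of `OrderHistory`: the vertices to order are appended in the deterministic order
given by `Finset.toList`. -/
noncomputable def orderOne (dag : Finset (Vertex 𝕋 P.n)) (ordered : List (Vertex 𝕋 P.n))
    (anchor : Vertex 𝕋 P.n) : List (Vertex 𝕋 P.n) :=
  ordered ++
    (dag.filter (fun v => 1 ≤ v.round ∧ P.PathExists dag anchor v ∧ v ∉ ordered)).toList

/-- `OrderAnchors(v)` followed by `OrderHistory()`. -/
noncomputable def orderAnchors (s : P.State) (v : Vertex 𝕋 P.n) : P.State :=
  if v.round ≤ s.lastOrdered then s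
  else
    { s with
      lastOrdered := v.round
      ordered := (P.anchorStack s.dag s.lastOrdered (v.round - 2) v [v]).foldl
        (P.orderOne s.dag) s.ordered }

open Classical in
/-- `TryCommitting(v)`, with direct commit threshold `2 f + 1`. -/
noncomputable def tryCommitting (s : P.State) (v : Vertex 𝕋 P.n) : P.State :=
  match P.getAnchor s.dag (v.round - 1) with
  | none => s
  | some anchor =>
    if 2 * P.f + 1 ≤ ((P.layer s.dag v.round).filter (fun u => anchor ∈ u.edges)).card then
      P.orderAnchors s anchor
    else s

/-! #### DAG construction -/

open Classical in
/-- Move `v` from the buffer to the DAG if all its parents are in the DAG. -/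
noncomputable def tryInsert (s : P.State) (v : Vertex 𝕋 P.n) : P.State :=
  if ∀ u ∈ v.edges, u ∈ s.dag then
    P.tryCommitting { s with buffer := s.buffer.erase v, dag := insert v s.dag } v
  else s

/-- Run the loop over the buffer until nothing more can be inserted: every pass inserts at least one
vertex unless none can be inserted, so `buffer.length` passes are enough. -/
noncomputable def drain (s : P.State) : P.State :=
  (fun s' : P.State => s'.buffer.foldl P.tryInsert s')^[s.buffer.length] s

/-- The vertices of round `r`, with their certificates, as an array indexed by the source. -/
noncomputable def refArray (cert : Vertex 𝕋 P.n → 𝕋.Cert) (dag : Finset (Vertex 𝕋 P.n)) (r : ℕ)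
    (i : Fin P.n) : Option (Ref 𝕋 P.n) :=
  (P.lookup dag r i).map (fun v => (v, cert v))

open Classical in
/-- The set of entries of an array. -/
noncomputable def entries (a : Fin P.n → Option (Ref 𝕋 P.n)) : Finset (Ref 𝕋 P.n) :=
  Finset.univ.biUnion (fun i => (a i).toFinset)

/-- The ALBA sample drawn by `VerifiablySample`. -/
noncomputable def drawSample (hash : 𝕋.Comm → P.Seed) (a : Fin P.n → Option (Ref 𝕋 P.n)) :
    List (Ref 𝕋 P.n) :=
  P.alba.prove (hash (P.vc.commit a)) (P.entries a)

/-- `CreateNewVertex`, called in round `s.round` to create a vertex of the next round. -/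
noncomputable def createVertex (hash : 𝕋.Comm → P.Seed) (cert : Vertex 𝕋 P.n → 𝕋.Cert)
    (i : Fin P.n) (s : P.State) (b : 𝕋.Block) : Vertex 𝕋 P.n :=
  let a := P.refArray cert s.dag s.round
  let sample := P.drawSample hash a
  Vertex.node (s.round + 1) i b (sample.map Prod.fst)
    (s.own :: (P.getAnchor s.dag s.round).toList)
    (P.vc.commit a) (sample.map (fun x => P.vc.proof a x.1.source))

open Classical in
/-- `ValidateVertex(v, round, k)`, including `ValidateSample`. -/
noncomputable def Valid (hash : 𝕋.Comm → P.Seed) (cert : Vertex 𝕋 P.n → 𝕋.Cert)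
    (round : ℕ) (k : Fin P.n) : Vertex 𝕋 P.n → Prop
  | .genesis _ => False
  | .node r src _ sample links c openings =>
    src = k ∧ r = round ∧ (sample ++ links).toFinset.card ≤ P.D + 2 ∧
    (∀ u ∈ sample ++ links, u.round + 1 = r) ∧
    List.Forall₂ (fun u o => P.vc.verify c u.source (some (u, cert u)) o = true) sample openings ∧
    P.alba.verify (hash c) (sample.map (fun u => (u, cert u))) = true

open Classical in
/-- First half of a tick: new messages are enqueued, the valid vertices among those delivered by
reliable broadcast are buffered, and the buffer is processed. -/
noncomputable def receive (hash : 𝕋.Comm → P.Seed) (cert : Vertex 𝕋 P.n → 𝕋.Cert)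
    (inbox : List (Vertex 𝕋 P.n × ℕ × Fin P.n)) (input : List 𝕋.Block) (s : P.State) : P.State :=
  P.drain { s with
    queue := s.queue ++ input
    buffer := s.buffer ++
      (inbox.filter (fun e => P.Valid hash cert e.2.1 e.2.2 e.1)).map Prod.fst }

open Classical in
/-- Second half of a tick: advance the round if possible, creating and broadcasting a vertex. -/
noncomputable def advance (hash : 𝕋.Comm → P.Seed) (cert : Vertex 𝕋 P.n → 𝕋.Cert)
    (i : Fin P.n) (now : ℕ) (s : P.State) : P.State × Option (Vertex 𝕋 P.n) :=
  match s.queue with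
  | [] => (s, none)
  | b :: rest =>
    if P.MayAdvance s now then
      let v := P.createVertex hash cert i s b
      ({ s with round := s.round + 1, timer := now, queue := rest, own := v }, some v)
    else (s, none)

end Protocol

/-! ### Executions under partial synchrony -/

/-- Everything that the adversary, the environment and chance determine in one execution, in
discrete time: which validators are never corrupted, the global stabilization time, the messages
`a_bcast` by each validator at each tick, the events `r_deliver(v, r, k)` of each validator at each
tick, the values of the hash function, the certificates, and the vertex (if any) certified by the
reliable broadcast with sequence number `r` and sender `k`. -/
structure Execution {𝕋 : Alphabet} (P : Protocol 𝕋) where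
  correct : Finset (Fin P.n)
  gst : ℕ
  input : Fin P.n → ℕ → List 𝕋.Block
  inbox : Fin P.n → ℕ → List (Vertex 𝕋 P.n × ℕ × Fin P.n)
  hash : 𝕋.Comm → P.Seed
  cert : Vertex 𝕋 P.n → 𝕋.Cert
  certified : ℕ → Fin P.n → Option (Vertex 𝕋 P.n)

namespace Execution

variable {𝕋 : Alphabet} {P : Protocol 𝕋} (X : Execution P)

/-- The state of validator `i`, if it follows the protocol, at the beginning of tick `t`. -/
noncomputable def state (i : Fin P.n) : ℕ → P.State
  | 0 => P.init i
  | t + 1 => (P.advance X.hash X.cert i t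
      (P.receive X.hash X.cert (X.inbox i t) (X.input i t) (state i t))).1

/-- The state in the middle of tick `t`, when the validator decides whether to advance. -/
noncomputable def midState (i : Fin P.n) (t : ℕ) : P.State :=
  P.receive X.hash X.cert (X.inbox i t) (X.input i t) (X.state i t)

/-- The vertex that validator `i` passes to `r_bcast` at tick `t`, if any. -/
noncomputable def rbcast (i : Fin P.n) (t : ℕ) : Option (Vertex 𝕋 P.n) :=
  (P.advance X.hash X.cert i t (X.midState i t)).2

/-- The array to which validator `i` commits when it creates a vertex at tick `t`. -/
noncomputable def array (i : Fin P.n) (t : ℕ) : Fin P.n → Option (Ref 𝕋 P.n) :=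
  P.refArray X.cert (X.midState i t).dag (X.midState i t).round

/-- The execution is one of `n = 3 f + 1` validators, at most `f` of them faulty, using a Byzantine
reliable broadcast with network delay bound `Δ` after the global stabilization time, which is at most
`G`; correct validators always have a block to propose. -/
structure Admissible (Δ G : ℕ) : Prop where
  card_correct : 2 * P.f + 1 ≤ X.correct.card
  gst_le : X.gst ≤ G
  certified_genesis : ∀ i, X.certified 0 i = some (Vertex.genesis i)
  /-- All correct validators deliver the same vertex for a given sender and sequence number. -/
  certified_of_deliver : ∀ i ∈ X.correct, ∀ t v r k, (v, r, k) ∈ X.inbox i t →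
    X.certified r k = some v
  /-- Integrity: at most one delivery per sender and sequence number. -/
  integrity : ∀ i ∈ X.correct, ∀ t t' v v' r k, (v, r, k) ∈ X.inbox i t →
    (v', r, k) ∈ X.inbox i t' → t = t'
  nodup : ∀ i ∈ X.correct, ∀ t, (X.inbox i t).Nodup
  /-- No creation: what is delivered from a correct sender has been broadcast by it before. -/
  no_creation : ∀ i ∈ X.correct, ∀ k ∈ X.correct, ∀ t v r, (v, r, k) ∈ X.inbox i t →
    v.round = r ∧ ∃ t' < t, X.rbcast k t' = some v
  /-- Validity, with the delay bound. -/
  validity : ∀ k ∈ X.correct, ∀ t v, X.rbcast k t = some v → ∀ j ∈ X.correct,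
    ∃ t' ≤ max t X.gst + Δ, (v, v.round, k) ∈ X.inbox j t'
  /-- Agreement, with the delay bound. -/
  agreement : ∀ i ∈ X.correct, ∀ t v r k, (v, r, k) ∈ X.inbox i t → ∀ j ∈ X.correct,
    ∃ t' ≤ max t X.gst + Δ, (v, r, k) ∈ X.inbox j t'
  backlog : ∀ i ∈ X.correct, ∀ t, (X.state i t).queue ++ X.input i t ≠ []

/-- All messages that validator `i` has `a_bcast` up to tick `t`, in order. -/
def broadcasts (i : Fin P.n) (t : ℕ) : List 𝕋.Block :=
  (List.range (t + 1)).flatMap (X.input i)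

/-- Validator `i` invokes `a_bcast(m, s)`: `m` is its `s`-th message, `s = 1, 2, …`. -/
def ABcast (i : Fin P.n) (m : 𝕋.Block) (s : ℕ) : Prop :=
  1 ≤ s ∧ ∃ t, (X.broadcasts i t)[s - 1]? = some m

/-- Validator `i` has output `a_deliver(m, s, k)` before tick `t`. -/
def ADelivered (i : Fin P.n) (t : ℕ) (m : 𝕋.Block) (s : ℕ) (k : Fin P.n) : Prop :=
  ∃ v ∈ (X.state i t).ordered, v.block = some m ∧ v.round = s ∧ v.source = k

/-- Agreement for everything that is delivered before tick `τ`. -/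
def Agreement (τ : ℕ) : Prop :=
  ∀ i ∈ X.correct, ∀ m s k, X.ADelivered i τ m s k →
    ∀ j ∈ X.correct, ∃ t, X.ADelivered j t m s k

/-- Validity for the first `τ` messages of every correct validator. -/
def Validity (τ : ℕ) : Prop :=
  ∀ k ∈ X.correct, ∀ m, ∀ s ≤ τ, X.ABcast k m s → ∃ t, X.ADelivered k t m s k

end Execution

/-! ### Randomness and the computationally bounded adversary -/

/-- The hash function as a lazily sampled random oracle in a random execution `X`. The log lists the
evaluations of the oracle by all validators and the adversary in their order: `comm k` is the
commitment hashed by the `k`-th evaluation, and `vec k` is the array of certified references which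
the evaluating party can open it to (`none` where there is no such reference). `ℱ k` is what is known
just before that evaluation. `budget t` bounds the number of evaluations in the ticks up to `t`. -/
structure HashLog {𝕋 : Alphabet} {P : Protocol 𝕋} {Ω : Type} [mΩ : MeasurableSpace Ω]
    (μ : Measure Ω) (X : Ω → Execution P) where
  ℱ : Filtration ℕ mΩ
  comm : ℕ → Ω → 𝕋.Comm
  vec : ℕ → Ω → Fin P.n → Option (Ref 𝕋 P.n)
  budget : ℕ → ℕ
  adapted_comm : ∀ k c, MeasurableSet[ℱ k] {ω | comm k ω = c}
  adapted_vec : ∀ k a, MeasurableSet[ℱ k] {ω | vec k ω = a}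
  measurable_hash : ∀ c, Measurable (fun ω => (X ω).hash c)
  /-- The answer to an evaluation is known afterwards. -/
  answer : ∀ k c (B : Set P.Seed), MeasurableSet B →
    MeasurableSet[ℱ (k + 1)] {ω | comm k ω = c ∧ (X ω).hash c ∈ B}
  /-- The answer to the first evaluation at `c` is independent of all that is known before. -/
  fresh : ∀ k c (A : Set Ω) (B : Set P.Seed), MeasurableSet[ℱ k] A → MeasurableSet B →
    (∀ ω ∈ A, comm k ω = c ∧ ∀ j < k, comm j ω ≠ c) →
    μ (A ∩ {ω | (X ω).hash c ∈ B}) = μ A * P.seedLaw B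
  vec_certified : ∀ᵐ ω ∂μ, ∀ k i v σ, vec k ω i = some (v, σ) →
    (X ω).certified v.round i = some v ∧ (X ω).cert v = σ
  /-- Correct validators hash when they create a vertex and when they validate one. -/
  logged_create : ∀ᵐ ω ∂μ, ∀ i ∈ (X ω).correct, ∀ t, ((X ω).rbcast i t).isSome = true →
    ∃ k < budget t, comm k ω = P.vc.commit ((X ω).array i t)
  logged_validate : ∀ᵐ ω ∂μ, ∀ i ∈ (X ω).correct, ∀ t, ∀ e ∈ (X ω).inbox i t,
    ∀ c ∈ e.1.comm, ∃ k < budget t, comm k ω = c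

namespace HashLog

variable {𝕋 : Alphabet} {P : Protocol 𝕋} {Ω : Type} [mΩ : MeasurableSpace Ω]
  {μ : Measure Ω} {X : Ω → Execution P} (L : HashLog μ X)

/-- The `k`-th evaluation is the first one at `c`. -/
def FirstAt (ω : Ω) (k : ℕ) (c : 𝕋.Comm) : Prop :=
  L.comm k ω = c ∧ ∀ j < k, L.comm j ω ≠ c

/-- The binding property of commitments to certified references is broken before or at tick `t`: a
correct validator commits to an array, or has in its DAG a vertex with an (accepted) opening, that
differs from the array fixed when the commitment was first hashed. -/
def bindingBroken (t : ℕ) : Set Ω :=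
  {ω | ∃ i ∈ (X ω).correct, ∃ t' ≤ t,
    (((X ω).rbcast i t').isSome = true ∧
      ∃ k, L.FirstAt ω k (P.vc.commit ((X ω).array i t')) ∧ L.vec k ω ≠ (X ω).array i t') ∨
    (∃ v ∈ ((X ω).midState i t').dag, ∃ c ∈ v.comm, ∃ k, L.FirstAt ω k c ∧
      ∃ u ∈ v.sample, L.vec k ω u.source ≠ some (u, (X ω).cert u))}

end HashLog

end SparseBullshark

namespace SparseBullshark

open scoped Classical

/-! Randomness enters only through the seeds of ALBA. When a commitment is hashed for the first
time, the attached array is already fixed and the seed is fresh. A union bound over the polynomially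
many evaluations up to a polynomial horizon `H` shows that, except with exponentially small
probability, no seed is bad for its array (`measure_hashBad_le`). Binding carries this over to the
arrays and samples that occur in the protocol. Two deterministic facts result. `Complete`: vertices
of correct validators pass validation. `Sound`: a vertex two rounds above an anchor with 2f+1
supporters samples one of them, because at most f certified entries of the intermediate round are
not supporters. Which anchor becomes supported need not be settled at hashing time, so the union
bound ranges over every vertex referenced by entries of the array with at most D+2 edges.

Agreement: under `Sound` every vertex at least two rounds above a supported anchor reaches it
(`reach_supported`). So the last anchor that a validator ordered directly has all supported anchors
of the DAG in its history, and that history is ordered (`ordered_of_supported`). Every ordered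
vertex lies in the history of some supported anchor, and DAG contents spread to all correct
validators within Δ after GST (`dag_transfer`).

Validity: the potential is the lag of a correct validator k, the largest delay of its entry into a
round behind another correct validator. After GST the lag does not grow once it is at least Δ
(`Lag.succ`), and it drops by one, down to Δ, whenever k leads an even round (`Lag.succ_leader`).
Once the lag is at most Δ, the anchor of k reaches everybody within 2Δ, hence before the timeout, so
all correct validators reference it (`Lag.supported`). The links of k to its own predecessors put
all its earlier vertices into the history of this anchor (`reach_own`). -/

/-- `u` is reachable from `v` along edges through vertices of positive round. -/
def Reach {𝕋 : Alphabet} {n : ℕ} (v u : Vertex 𝕋 n) : Prop :=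
  Relation.ReflTransGen (fun a b => b ∈ a.edges ∧ 1 ≤ b.round) v u

namespace Protocol

variable {𝕋 : Alphabet} (P : Protocol 𝕋)

/-! ### Vertices accepted by validation -/

/-- `v` passes validation when it is delivered for its own round and source. -/
def Acceptable (hash : 𝕋.Comm → P.Seed) (cert : Vertex 𝕋 P.n → 𝕋.Cert) (v : Vertex 𝕋 P.n) : Prop :=
  P.Valid hash cert v.round v.source v

variable {P}

theorem Valid.round_source {hash : 𝕋.Comm → P.Seed} {cert : Vertex 𝕋 P.n → 𝕋.Cert} {r : ℕ}
    {k : Fin P.n} {v : Vertex 𝕋 P.n} (h : P.Valid hash cert r k v) :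
    v.round = r ∧ v.source = k := by
  cases v with
  | genesis i => exact h.elim
  | node r' i b s l c o => exact ⟨h.2.1, h.1⟩

theorem Valid.acceptable {hash : 𝕋.Comm → P.Seed} {cert : Vertex 𝕋 P.n → 𝕋.Cert} {r : ℕ}
    {k : Fin P.n} {v : Vertex 𝕋 P.n} (h : P.Valid hash cert r k v) :
    P.Acceptable hash cert v := by
  obtain ⟨h1, h2⟩ := h.round_source
  subst h1 h2
  exact h

theorem Acceptable.edges_round {hash : 𝕋.Comm → P.Seed} {cert : Vertex 𝕋 P.n → 𝕋.Cert}
    {v : Vertex 𝕋 P.n} (h : P.Acceptable hash cert v) : ∀ u ∈ v.edges, u.round + 1 = v.round := by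
  cases v with
  | genesis i => exact h.elim
  | node r i b s l c o => exact h.2.2.2.1

theorem Acceptable.exists_sample {hash : 𝕋.Comm → P.Seed} {cert : Vertex 𝕋 P.n → 𝕋.Cert}
    {v : Vertex 𝕋 P.n} (h : P.Acceptable hash cert v) : ∃ u, u ∈ v.sample := by
  cases v with
  | genesis i => exact h.elim
  | node r i b s l c o =>
    have h1 := P.alba.verify_length _ _ h.2.2.2.2.2
    have h2 := P.one_le_D
    rw [List.length_map] at h1
    exact List.exists_mem_of_length_pos (l := s) (by omega)

theorem _root_.SparseBullshark.Vertex.sample_subset_edges {n : ℕ} (v : Vertex 𝕋 n) :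
    ∀ u ∈ v.sample, u ∈ v.edges := by
  cases v with
  | genesis i => simp [Vertex.sample]
  | node r i b s l c o =>
    intro u hu
    exact List.mem_append_left _ hu

theorem Acceptable.one_le_round {hash : 𝕋.Comm → P.Seed} {cert : Vertex 𝕋 P.n → 𝕋.Cert}
    {v : Vertex 𝕋 P.n} (h : P.Acceptable hash cert v) : 1 ≤ v.round := by
  obtain ⟨u, hu⟩ := h.exists_sample
  have := h.edges_round u (v.sample_subset_edges u hu)
  omega

theorem Acceptable.card_edges {hash : 𝕋.Comm → P.Seed} {cert : Vertex 𝕋 P.n → 𝕋.Cert}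
    {v : Vertex 𝕋 P.n} (h : P.Acceptable hash cert v) : v.edges.toFinset.card ≤ P.D + 2 := by
  cases v with
  | genesis i => exact h.elim
  | node r i b s l c o => exact h.2.2.1

theorem Acceptable.verify {hash : 𝕋.Comm → P.Seed} {cert : Vertex 𝕋 P.n → 𝕋.Cert}
    {v : Vertex 𝕋 P.n} (h : P.Acceptable hash cert v) :
    ∃ c ∈ v.comm, P.alba.verify (hash c) (v.sample.map (fun u => (u, cert u))) = true := by
  cases v with
  | genesis i => exact h.elim
  | node r i b s l c o => exact ⟨c, rfl, h.2.2.2.2.2⟩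

/-! ### Ordering leaves the rest of the state unchanged -/

section Frame

variable (s : P.State) (v : Vertex 𝕋 P.n)

theorem tryCommitting_frame :
    (P.tryCommitting s v).buffer = s.buffer ∧ (P.tryCommitting s v).dag = s.dag ∧
    (P.tryCommitting s v).round = s.round ∧ (P.tryCommitting s v).timer = s.timer ∧
    (P.tryCommitting s v).queue = s.queue ∧ (P.tryCommitting s v).own = s.own := by
  unfold tryCommitting orderAnchors
  repeat' split
  all_goals simp

@[simp] theorem tryCommitting_buffer : (P.tryCommitting s v).buffer = s.buffer :=
  (tryCommitting_frame s v).1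

@[simp] theorem tryCommitting_dag : (P.tryCommitting s v).dag = s.dag :=
  (tryCommitting_frame s v).2.1

theorem tryInsert_of_parents (h : ∀ u ∈ v.edges, u ∈ s.dag) : P.tryInsert s v =
    P.tryCommitting { s with buffer := s.buffer.erase v, dag := insert v s.dag } v := by
  unfold tryInsert
  rw [if_pos h]

theorem tryInsert_of_not_parents (h : ¬ ∀ u ∈ v.edges, u ∈ s.dag) : P.tryInsert s v = s := by
  unfold tryInsert
  rw [if_neg h]

theorem subset_dag_tryInsert : s.dag ⊆ (P.tryInsert s v).dag := by
  by_cases h : ∀ u ∈ v.edges, u ∈ s.dag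
  · rw [tryInsert_of_parents s v h, tryCommitting_dag]
    exact Finset.subset_insert _ _
  · rw [tryInsert_of_not_parents s v h]

theorem length_buffer_tryInsert_le : (P.tryInsert s v).buffer.length ≤ s.buffer.length := by
  by_cases h : ∀ u ∈ v.edges, u ∈ s.dag
  · rw [tryInsert_of_parents s v h, tryCommitting_buffer]
    exact List.length_erase_le
  · rw [tryInsert_of_not_parents s v h]

end Frame

/-! ### Processing the buffer -/

theorem foldl_tryInsert_induction {M : P.State → Prop} {V : Vertex 𝕋 P.n → Prop}
    (step : ∀ s v, M s → V v → M (P.tryInsert s v)) (l : List (Vertex 𝕋 P.n)) (s : P.State)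
    (hs : M s) (hl : ∀ v ∈ l, V v) : M (l.foldl P.tryInsert s) := by
  induction l generalizing s with
  | nil => exact hs
  | cons a l ih =>
    exact ih _ (step s a hs (hl a (by simp))) (fun v hv => hl v (by simp [hv]))

/-- A property of the state that is preserved by insertions is preserved by `drain`. -/
theorem drain_induction {M : P.State → Prop} {V : Vertex 𝕋 P.n → Prop}
    (step : ∀ s v, M s → V v → M (P.tryInsert s v)) (s : P.State)
    (hs : M s) (hV : ∀ v ∈ s.buffer, V v) : M (P.drain s) ∧ ∀ v ∈ (P.drain s).buffer, V v := by
  have key : ∀ k : ℕ, ∀ s : P.State, M s → (∀ v ∈ s.buffer, V v) →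
      M ((fun s' : P.State => s'.buffer.foldl P.tryInsert s')^[k] s) ∧
      ∀ v ∈ ((fun s' : P.State => s'.buffer.foldl P.tryInsert s')^[k] s).buffer, V v := by
    intro k
    induction k with
    | zero => exact fun s h1 h2 => ⟨h1, h2⟩
    | succ k ih =>
      intro s h1 h2
      rw [Function.iterate_succ_apply]
      apply ih
      · exact foldl_tryInsert_induction step _ _ h1 h2
      · refine foldl_tryInsert_induction (M := fun s => ∀ v ∈ s.buffer, V v) (V := V) ?_ _ _ h2 h2
        intro s v hs _
        by_cases h : ∀ u ∈ v.edges, u ∈ s.dag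
        · rw [tryInsert_of_parents s v h, tryCommitting_buffer]
          exact fun u hu => hs u (List.mem_of_mem_erase hu)
        · rw [tryInsert_of_not_parents s v h]
          exact hs
  exact key _ s hs hV

/-- No vertex in the buffer can be inserted. -/
def Stable (s : P.State) : Prop := ∀ v ∈ s.buffer, ¬ ∀ u ∈ v.edges, u ∈ s.dag

theorem Stable.foldl {s : P.State} (h : Stable s) (l : List (Vertex 𝕋 P.n))
    (hl : ∀ v ∈ l, v ∈ s.buffer) : l.foldl P.tryInsert s = s := by
  induction l with
  | nil => rfl
  | cons a l ih =>
    rw [List.foldl_cons, tryInsert_of_not_parents s a (h a (hl a (by simp)))]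
    exact ih (fun v hv => hl v (by simp [hv]))

theorem length_buffer_foldl_le (l : List (Vertex 𝕋 P.n)) (s : P.State) :
    (l.foldl P.tryInsert s).buffer.length ≤ s.buffer.length := by
  induction l generalizing s with
  | nil => exact le_rfl
  | cons a l ih => exact (ih _).trans (length_buffer_tryInsert_le s a)

/-- Parents never leave the DAG, so the pass either erases some buffered vertex before it reaches
`v` or erases `v` itself. The buffer length is thus a decreasing measure for `drain`. -/
theorem length_buffer_foldl_lt {v : Vertex 𝕋 P.n} (l : List (Vertex 𝕋 P.n)) (s : P.State)
    (hv : v ∈ l) (hb : v ∈ s.buffer) (hp : ∀ u ∈ v.edges, u ∈ s.dag) :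
    (l.foldl P.tryInsert s).buffer.length < s.buffer.length := by
  induction l generalizing s with
  | nil => simp at hv
  | cons a l ih =>
    rw [List.foldl_cons]
    by_cases ha : ∀ u ∈ a.edges, u ∈ s.dag
    · by_cases hab : a ∈ s.buffer
      · refine (length_buffer_foldl_le l _).trans_lt ?_
        rw [tryInsert_of_parents s a ha, tryCommitting_buffer]
        have h1 := List.length_pos_of_mem hab
        change (s.buffer.erase a).length < _
        rw [List.length_erase_of_mem hab]
        omega
      · have hva : v ≠ a := fun h => hab (h ▸ hb)
        have hvl : v ∈ l := by
          rcases List.mem_cons.1 hv with h | h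
          · exact absurd h hva
          · exact h
        refine (ih _ hvl ?_ (fun u hu => subset_dag_tryInsert s a (hp u hu))).trans_le
          (length_buffer_tryInsert_le s a)
        rw [tryInsert_of_parents s a ha, tryCommitting_buffer]
        exact (List.mem_erase_of_ne hva).2 hb
    · rw [tryInsert_of_not_parents s a ha]
      refine ih s ?_ hb hp
      rcases List.mem_cons.1 hv with h | h
      · exact absurd (h ▸ hp) ha
      · exact h

/-- A pass over an unstable buffer shortens it and a pass over a stable one is the identity, so as
many passes as the buffer is long are enough. -/
theorem drain_stable (s : P.State) : Stable (P.drain s) := by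
  have key : ∀ k : ℕ, ∀ s : P.State, s.buffer.length ≤ k →
      Stable ((fun s' : P.State => s'.buffer.foldl P.tryInsert s')^[k] s) := by
    intro k
    induction k with
    | zero =>
      intro s hs v hv
      have : 0 < s.buffer.length := List.length_pos_of_mem hv
      omega
    | succ k ih =>
      intro s hs
      by_cases h : Stable s
      · have hfix : s.buffer.foldl P.tryInsert s = s := h.foldl _ (fun v hv => hv)
        rw [Function.iterate_fixed hfix]
        exact h
      · rw [Function.iterate_succ_apply]
        apply ih
        unfold Stable at h
        push Not at h
        obtain ⟨v, hv, hp⟩ := h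
        have := length_buffer_foldl_lt s.buffer s hv hv hp
        omega
  exact key _ s le_rfl

theorem subset_dag_drain (s : P.State) : s.dag ⊆ (P.drain s).dag :=
  (drain_induction (M := fun s' => s.dag ⊆ s'.dag) (V := fun _ => True)
    (fun s' v h _ => h.trans (subset_dag_tryInsert s' v)) s (Finset.Subset.refl _)
    (fun _ _ => trivial)).1

theorem mem_buffer_or_dag_drain {s : P.State} {v : Vertex 𝕋 P.n} (h : v ∈ s.buffer) :
    v ∈ (P.drain s).buffer ∨ v ∈ (P.drain s).dag := by
  refine (drain_induction (M := fun s' => v ∈ s'.buffer ∨ v ∈ s'.dag) (V := fun _ => True)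
    ?_ s (Or.inl h) (fun _ _ => trivial)).1
  intro s' a hs' _
  by_cases ha : ∀ u ∈ a.edges, u ∈ s'.dag
  · rw [tryInsert_of_parents s' a ha, tryCommitting_buffer, tryCommitting_dag]
    by_cases hva : v = a
    · exact Or.inr (by simp [hva])
    · rcases hs' with h | h
      · exact Or.inl ((List.mem_erase_of_ne hva).2 h)
      · exact Or.inr (by simp [h])
  · rwa [tryInsert_of_not_parents s' a ha]

theorem drain_frame (s : P.State) : (P.drain s).round = s.round ∧ (P.drain s).timer = s.timer ∧
    (P.drain s).queue = s.queue ∧ (P.drain s).own = s.own := by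
  refine (drain_induction (M := fun s' => s'.round = s.round ∧ s'.timer = s.timer ∧
    s'.queue = s.queue ∧ s'.own = s.own) (V := fun _ => True) ?_ s ⟨rfl, rfl, rfl, rfl⟩
    (fun _ _ => trivial)).1
  intro s' a hs' _
  by_cases ha : ∀ u ∈ a.edges, u ∈ s'.dag
  · rw [tryInsert_of_parents s' a ha]
    obtain ⟨-, -, h1, h2, h3, h4⟩ := tryCommitting_frame
      { s' with buffer := s'.buffer.erase a, dag := insert a s'.dag } a
    rw [h1, h2, h3, h4]
    exact hs'
  · rwa [tryInsert_of_not_parents s' a ha]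

end Protocol
end SparseBullshark

namespace SparseBullshark
open scoped Classical

theorem Reach.one_le_round {𝕋 : Alphabet} {n : ℕ} {v u : Vertex 𝕋 n} (h : Reach v u) (hv : 1 ≤ v.round) :
    1 ≤ u.round := by
  induction h with
  | refl => exact hv
  | tail _ h _ => exact h.2

namespace Protocol
variable {𝕋 : Alphabet} {P : Protocol 𝕋}

/-! ### Invariants of the DAG -/

/-- The DAG contains round `0`, its other vertices are acceptable, it is closed under parents and
has at most one vertex for each round and source, given by `cf`. -/
structure DagInv (hash : 𝕋.Comm → P.Seed) (cert : Vertex 𝕋 P.n → 𝕋.Cert)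
    (cf : ℕ → Fin P.n → Option (Vertex 𝕋 P.n)) (dag : Finset (Vertex 𝕋 P.n)) : Prop where
  genesis_mem : ∀ i, Vertex.genesis i ∈ dag
  acceptable : ∀ v ∈ dag, 1 ≤ v.round → P.Acceptable hash cert v
  eq_genesis : ∀ v ∈ dag, v.round = 0 → ∃ i, v = Vertex.genesis i
  certified : ∀ v ∈ dag, cf v.round v.source = some v
  closed : ∀ v ∈ dag, ∀ u ∈ v.edges, u ∈ dag

theorem mem_of_lookup {dag : Finset (Vertex 𝕋 P.n)} {r : ℕ} {i : Fin P.n} {v : Vertex 𝕋 P.n}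
    (h : P.lookup dag r i = some v) : v ∈ dag ∧ v.round = r ∧ v.source = i := by
  unfold lookup at h
  split at h
  · next h' =>
    have := h'.choose_spec
    rw [Option.some.injEq] at h
    rw [h] at this
    exact this
  · simp at h

theorem mem_of_getAnchor {dag : Finset (Vertex 𝕋 P.n)} {r : ℕ} {v : Vertex 𝕋 P.n}
    (h : P.getAnchor dag r = some v) :
    v ∈ dag ∧ v.round = r ∧ v.source = P.leader r ∧ r % 2 = 0 := by
  unfold getAnchor at h
  split at h
  · simp at h
  · obtain ⟨h1, h2, h3⟩ := mem_of_lookup h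
    exact ⟨h1, h2, h3, by omega⟩

namespace DagInv

variable {hash : 𝕋.Comm → P.Seed} {cert : Vertex 𝕋 P.n → 𝕋.Cert}
  {cf : ℕ → Fin P.n → Option (Vertex 𝕋 P.n)} {dag : Finset (Vertex 𝕋 P.n)}

theorem unique (I : DagInv hash cert cf dag) {v w : Vertex 𝕋 P.n} (hv : v ∈ dag) (hw : w ∈ dag)
    (hr : v.round = w.round) (hs : v.source = w.source) : v = w := by
  have h1 := I.certified v hv
  have h2 := I.certified w hw
  rw [hr, hs, h2] at h1
  exact (Option.some.inj h1).symm

theorem edges_round (I : DagInv hash cert cf dag) {v u : Vertex 𝕋 P.n} (hv : v ∈ dag)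
    (hu : u ∈ v.edges) : u.round + 1 = v.round := by
  rcases Nat.eq_zero_or_pos v.round with h | h
  · obtain ⟨i, rfl⟩ := I.eq_genesis v hv h
    simp [Vertex.edges] at hu
  · exact (I.acceptable v hv h).edges_round u hu

theorem lookup_eq (I : DagInv hash cert cf dag) {v : Vertex 𝕋 P.n} (hv : v ∈ dag) {r : ℕ}
    {i : Fin P.n} (hr : v.round = r) (hs : v.source = i) : P.lookup dag r i = some v := by
  have h : ∃ v ∈ dag, v.round = r ∧ v.source = i := ⟨v, hv, hr, hs⟩
  unfold lookup
  rw [dif_pos h]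
  obtain ⟨h1, h2, h3⟩ := h.choose_spec
  rw [I.unique h1 hv (h2.trans hr.symm) (h3.trans hs.symm)]

theorem getAnchor_eq (I : DagInv hash cert cf dag) {v : Vertex 𝕋 P.n} (hv : v ∈ dag) {r : ℕ}
    (hr : v.round = r) (hs : v.source = P.leader r) (he : r % 2 = 0) :
    P.getAnchor dag r = some v := by
  unfold getAnchor
  rw [if_neg (by omega)]
  exact I.lookup_eq hv hr hs

theorem mem_of_reach (I : DagInv hash cert cf dag) {v u : Vertex 𝕋 P.n} (hv : v ∈ dag)
    (h : Reach v u) : u ∈ dag := by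
  induction h with
  | refl => exact hv
  | tail _ h ih => exact I.closed _ ih _ h.1

/-- Closure under parents makes the restriction of paths to the DAG void. Histories therefore do not
depend on the validator that computes them. -/
theorem pathExists_iff (I : DagInv hash cert cf dag) {v u : Vertex 𝕋 P.n} (hv : v ∈ dag) :
    P.PathExists dag v u ↔ Reach v u := by
  constructor
  · intro h
    induction h with
    | refl => exact Relation.ReflTransGen.refl
    | tail _ h2 ih => exact ih.tail ⟨h2.1, h2.2.2⟩
  · intro h
    induction h with
    | refl => exact Relation.ReflTransGen.refl
    | tail h1 h2 ih =>
      exact ih.tail ⟨h2.1, I.closed _ (I.mem_of_reach hv h1) _ h2.1, h2.2⟩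

theorem insert (I : DagInv hash cert cf dag) {v : Vertex 𝕋 P.n}
    (ha : P.Acceptable hash cert v) (hc : cf v.round v.source = some v)
    (hp : ∀ u ∈ v.edges, u ∈ dag) : DagInv hash cert cf (insert v dag) where
  genesis_mem i := Finset.mem_insert_of_mem (I.genesis_mem i)
  acceptable w hw h := by
    rcases Finset.mem_insert.1 hw with rfl | hw
    · exact ha
    · exact I.acceptable w hw h
  eq_genesis w hw h := by
    rcases Finset.mem_insert.1 hw with rfl | hw
    · have := ha.one_le_round
      omega
    · exact I.eq_genesis w hw h
  certified w hw := by
    rcases Finset.mem_insert.1 hw with rfl | hw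
    · exact hc
    · exact I.certified w hw
  closed w hw u hu := by
    rcases Finset.mem_insert.1 hw with rfl | hw
    · exact Finset.mem_insert_of_mem (hp u hu)
    · exact Finset.mem_insert_of_mem (I.closed w hw u hu)

end DagInv

/-! ### Invariants of the ordering -/

variable (P) in
/-- `a` is an anchor of positive round referenced by `2 f + 1` vertices of the next round. -/
def Supported (dag : Finset (Vertex 𝕋 P.n)) (a : Vertex 𝕋 P.n) : Prop :=
  a ∈ dag ∧ a.round % 2 = 0 ∧ 1 ≤ a.round ∧ a.source = P.leader a.round ∧
    2 * P.f + 1 ≤ ((P.layer dag (a.round + 1)).filter (fun u => a ∈ u.edges)).card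

theorem Supported.mono {dag dag' : Finset (Vertex 𝕋 P.n)} {a : Vertex 𝕋 P.n}
    (h : P.Supported dag a) (hd : dag ⊆ dag') : P.Supported dag' a :=
  ⟨hd h.1, h.2.1, h.2.2.1, h.2.2.2.1, h.2.2.2.2.trans (Finset.card_le_card
    (Finset.filter_subset_filter _ (Finset.filter_subset_filter _ hd)))⟩

/-- Everything that is ordered is in the history of a supported anchor, supported anchors are not
above the last ordered one, and the history of the latter is ordered. -/
structure OrderInv (s : P.State) : Prop where
  ordered : ∀ v ∈ s.ordered, 1 ≤ v.round ∧ ∃ a, P.Supported s.dag a ∧ Reach a v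
  supported : ∀ a, P.Supported s.dag a → a.round ≤ s.lastOrdered
  last : s.lastOrdered = 0 ∨ ∃ a, P.Supported s.dag a ∧ a.round = s.lastOrdered ∧
    ∀ v, Reach a v → v ∈ s.ordered

theorem mem_anchorStack_of_mem (dag : Finset (Vertex 𝕋 P.n)) (last r : ℕ) (anchor : Vertex 𝕋 P.n)
    (stack : List (Vertex 𝕋 P.n)) {x : Vertex 𝕋 P.n} (h : x ∈ stack) :
    x ∈ P.anchorStack dag last r anchor stack := by
  induction r using Nat.strong_induction_on generalizing anchor stack with
  | _ r ih =>
    match r, ih with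
    | 0, _ => exact h
    | 1, _ => exact h
    | r + 2, ih =>
      unfold anchorStack
      repeat' split
      · exact ih r (by omega) _ _ (List.mem_cons_of_mem _ h)
      · exact ih r (by omega) _ _ h
      · exact ih r (by omega) _ _ h
      · exact h

/-- Each anchor pushed is reachable from the one before it, so the stack contributes nothing outside
the history of the starting anchor. -/
theorem pathExists_of_mem_anchorStack (dag : Finset (Vertex 𝕋 P.n)) (last r : ℕ)
    (anchor : Vertex 𝕋 P.n) (stack : List (Vertex 𝕋 P.n)) {x : Vertex 𝕋 P.n}
    (h : x ∈ P.anchorStack dag last r anchor stack) : x ∈ stack ∨ P.PathExists dag anchor x := by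
  induction r using Nat.strong_induction_on generalizing anchor stack with
  | _ r ih =>
    match r, ih, h with
    | 0, _, h => exact Or.inl h
    | 1, _, h => exact Or.inl h
    | r + 2, ih, h =>
      unfold anchorStack at h
      split at h
      · split at h
        · next prev _ =>
          split at h
          · next hp =>
            rcases ih r (by omega) _ _ h with h1 | h1
            · rcases List.mem_cons.1 h1 with rfl | h1
              · exact Or.inr hp
              · exact Or.inl h1
            · exact Or.inr (hp.trans h1)
          · exact ih r (by omega) _ _ h
        · exact ih r (by omega) _ _ h
      · exact Or.inl h

theorem mem_foldl_orderOne (dag : Finset (Vertex 𝕋 P.n)) (stack : List (Vertex 𝕋 P.n))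
    (ordered : List (Vertex 𝕋 P.n)) (v : Vertex 𝕋 P.n) :
    v ∈ stack.foldl (P.orderOne dag) ordered ↔
      v ∈ ordered ∨ ∃ a ∈ stack, v ∈ dag ∧ 1 ≤ v.round ∧ P.PathExists dag a v := by
  induction stack generalizing ordered with
  | nil => simp
  | cons a l ih =>
    rw [List.foldl_cons, ih]
    unfold orderOne
    rw [List.mem_append, Finset.mem_toList, Finset.mem_filter]
    constructor
    · rintro ((h | h) | ⟨b, hb, h⟩)
      · exact Or.inl h
      · exact Or.inr ⟨a, by simp, h.1, h.2.1, h.2.2.1⟩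
      · exact Or.inr ⟨b, by simp [hb], h⟩
    · rintro (h | ⟨b, hb, h⟩)
      · exact Or.inl (Or.inl h)
      · rcases List.mem_cons.1 hb with rfl | hb
        · by_cases hv : v ∈ ordered
          · exact Or.inl (Or.inl hv)
          · exact Or.inl (Or.inr ⟨h.1, h.2.1, h.2.2, hv⟩)
        · exact Or.inr ⟨b, hb, h⟩

section Step

variable {hash : 𝕋.Comm → P.Seed} {cert : Vertex 𝕋 P.n → 𝕋.Cert}
  {cf : ℕ → Fin P.n → Option (Vertex 𝕋 P.n)}

/-- As a set, the output grows by exactly the history of `a`: the starting anchor is on the stack,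
and the other stacked anchors influence only the order. -/
theorem mem_ordered_orderAnchors {s : P.State} (I : DagInv hash cert cf s.dag)
    {a : Vertex 𝕋 P.n} (ha : a ∈ s.dag) (h1 : 1 ≤ a.round) (hlt : s.lastOrdered < a.round)
    (v : Vertex 𝕋 P.n) : v ∈ (P.orderAnchors s a).ordered ↔ v ∈ s.ordered ∨ Reach a v := by
  unfold orderAnchors
  rw [if_neg (by omega)]
  dsimp only
  rw [mem_foldl_orderOne]
  refine or_congr_right ⟨?_, ?_⟩
  · rintro ⟨b, hb, -, -, hp⟩
    rcases pathExists_of_mem_anchorStack _ _ _ _ _ hb with h | h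
    · rw [List.mem_singleton] at h
      subst h
      exact (I.pathExists_iff ha).1 hp
    · exact (I.pathExists_iff ha).1 (h.trans hp)
  · intro h
    exact ⟨a, mem_anchorStack_of_mem _ _ _ _ _ (by simp), I.mem_of_reach ha h,
      Reach.one_le_round h h1, (I.pathExists_iff ha).2 h⟩

/-- Ordering a supported anchor preserves the ordering invariant, up to the requirement that the
supported anchors are not above the last ordered one. -/
theorem OrderInv.tryCommitting {s : P.State} (I : DagInv hash cert cf s.dag) (v : Vertex 𝕋 P.n)
    (h1 : ∀ v ∈ s.ordered, 1 ≤ v.round ∧ ∃ a, P.Supported s.dag a ∧ Reach a v)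
    (h2 : ∀ a, P.Supported s.dag a → a.round ≤ s.lastOrdered ∨ a.round + 1 = v.round)
    (h3 : s.lastOrdered = 0 ∨ ∃ a, P.Supported s.dag a ∧ a.round = s.lastOrdered ∧
      ∀ v, Reach a v → v ∈ s.ordered) : OrderInv (P.tryCommitting s v) := by
  -- In the branches that leave the state unchanged, only anchors one round below `v` can violate
  -- the invariant.
  have hsame : (∀ a, P.Supported s.dag a → a.round + 1 = v.round → a.round ≤ s.lastOrdered) →
      OrderInv s := fun h => ⟨h1, fun a ha => (h2 a ha).elim id (h a ha), h3⟩
  unfold Protocol.tryCommitting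
  split
  · next hn =>
    apply hsame
    intro a ha hr
    have := I.getAnchor_eq ha.1 (r := v.round - 1) (by omega)
      (by rw [ha.2.2.2.1]; congr 1; omega) (by have := ha.2.1; omega)
    rw [hn] at this
    simp at this
  · next anchor hn =>
    obtain ⟨m1, m2, m3, m4⟩ := mem_of_getAnchor hn
    have huniq : ∀ a, P.Supported s.dag a → a.round + 1 = v.round → a = anchor := by
      intro a ha hr
      refine I.unique ha.1 m1 (by omega) ?_
      rw [ha.2.2.2.1, m3]
      congr 1
      omega
    split
    · next hcard =>
      by_cases hle : anchor.round ≤ s.lastOrdered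
      · have : P.orderAnchors s anchor = s := by
          unfold orderAnchors
          rw [if_pos hle]
        rw [this]
        apply hsame
        intro a ha hr
        rwa [huniq a ha hr]
      -- Truncated subtraction is harmless here: the anchor lies above `lastOrdered`, so its round
      -- `v.round - 1` is positive.
      · have hr : anchor.round + 1 = v.round := by omega
        have hsup : P.Supported s.dag anchor := by
          refine ⟨m1, by omega, by omega, by rw [m3, m2], ?_⟩
          rwa [hr]
        have hmem := mem_ordered_orderAnchors I m1 (by omega) (by omega : s.lastOrdered < anchor.round)
        have hdag : (P.orderAnchors s anchor).dag = s.dag := by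
          unfold orderAnchors
          rw [if_neg hle]
        have hlast : (P.orderAnchors s anchor).lastOrdered = anchor.round := by
          unfold orderAnchors
          rw [if_neg hle]
        refine ⟨?_, ?_, Or.inr ⟨anchor, ?_, hlast.symm, fun u hu => (hmem u).2 (Or.inr hu)⟩⟩
        · intro u hu
          rw [hdag]
          rcases (hmem u).1 hu with h | h
          · exact h1 u h
          · exact ⟨Reach.one_le_round h (by omega), anchor, hsup, h⟩
        · intro a ha
          rw [hdag] at ha
          rw [hlast]
          rcases h2 a ha with h | h
          · omega
          · rw [huniq a ha h]
        · rwa [hdag]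
    · next hcard =>
      apply hsame
      intro a ha hr
      refine absurd ?_ hcard
      have := ha.2.2.2.2
      rwa [hr, huniq a ha hr] at this

/-- Inserting `v` changes only the layer of `v`, so only an anchor one round below can become
supported, and that is the one which `tryCommitting` examines. -/
theorem OrderInv.tryInsert {s : P.State} (I : DagInv hash cert cf s.dag) (O : OrderInv s)
    {v : Vertex 𝕋 P.n} (ha : P.Acceptable hash cert v) (hc : cf v.round v.source = some v) :
    DagInv hash cert cf (P.tryInsert s v).dag ∧ OrderInv (P.tryInsert s v) := by
  by_cases hp : ∀ u ∈ v.edges, u ∈ s.dag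
  · rw [tryInsert_of_parents s v hp]
    have I' := I.insert ha hc hp
    refine ⟨by rw [tryCommitting_dag]; exact I', OrderInv.tryCommitting (cf := cf) I' v ?_ ?_ ?_⟩
    · intro u hu
      obtain ⟨h1, a, h2, h3⟩ := O.ordered u hu
      exact ⟨h1, a, h2.mono (Finset.subset_insert _ _), h3⟩
    · rintro a ⟨a1, a2, a3, a4, a5⟩
      by_cases hr : a.round + 1 = v.round
      · exact Or.inr hr
      · left
        apply O.supported
        have hl : P.layer (insert v s.dag) (a.round + 1) = P.layer s.dag (a.round + 1) := by
          unfold layer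
          rw [Finset.filter_insert, if_neg (by omega)]
        dsimp only at a5
        rw [hl] at a5
        refine ⟨?_, a2, a3, a4, a5⟩
        -- The anchor was in the DAG before the insertion, being a parent of a supporter that was
        -- already there.
        obtain ⟨u, hu⟩ := Finset.card_pos.1 (by omega : 0 <
          ((P.layer s.dag (a.round + 1)).filter (fun u => a ∈ u.edges)).card)
        rw [Finset.mem_filter] at hu
        exact I.closed u (Finset.mem_filter.1 hu.1).1 a hu.2
    · rcases O.last with h | ⟨a, h1, h2⟩
      · exact Or.inl h
      · exact Or.inr ⟨a, h1.mono (Finset.subset_insert _ _), h2⟩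
  · rw [tryInsert_of_not_parents s v hp]
    exact ⟨I, O⟩

/-- Both invariants are preserved when acceptable certified vertices are processed. -/
theorem OrderInv.drain {s : P.State} (I : DagInv hash cert cf s.dag) (O : OrderInv s)
    (hb : ∀ v ∈ s.buffer, P.Acceptable hash cert v ∧ cf v.round v.source = some v) :
    DagInv hash cert cf (P.drain s).dag ∧ OrderInv (P.drain s) :=
  (drain_induction (M := fun s => DagInv hash cert cf s.dag ∧ OrderInv s)
    (fun _ _ h hv => OrderInv.tryInsert h.1 h.2 hv.1 hv.2) s ⟨I, O⟩ hb).1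

end Step

end Protocol
end SparseBullshark

namespace SparseBullshark
open scoped Classical

namespace Execution
variable {𝕋 : Alphabet} {P : Protocol 𝕋} {X : Execution P} {Δ G : ℕ}

/-! ### Single ticks -/

theorem midState_frame (i : Fin P.n) (t : ℕ) : (X.midState i t).round = (X.state i t).round ∧
    (X.midState i t).timer = (X.state i t).timer ∧
    (X.midState i t).queue = (X.state i t).queue ++ X.input i t ∧
    (X.midState i t).own = (X.state i t).own :=
  Protocol.drain_frame _

theorem state_succ (i : Fin P.n) (t : ℕ) : X.state i (t + 1) =
    (P.advance X.hash X.cert i t (X.midState i t)).1 := rfl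

theorem state_succ_frame (i : Fin P.n) (t : ℕ) :
    (X.state i (t + 1)).dag = (X.midState i t).dag ∧
    (X.state i (t + 1)).buffer = (X.midState i t).buffer ∧
    (X.state i (t + 1)).ordered = (X.midState i t).ordered ∧
    (X.state i (t + 1)).lastOrdered = (X.midState i t).lastOrdered := by
  rw [state_succ]
  unfold Protocol.advance
  repeat' split
  all_goals simp

theorem state_succ_of_rbcast_eq_none {i : Fin P.n} {t : ℕ} (h : X.rbcast i t = none) :
    X.state i (t + 1) = X.midState i t := by
  rw [state_succ]
  unfold rbcast at h
  unfold Protocol.advance at h ⊢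
  split at h
  · rfl
  · split at h
    · simp at h
    · next hm => rw [if_neg hm]

theorem rbcast_eq_some {i : Fin P.n} {t : ℕ} {v : Vertex 𝕋 P.n} (h : X.rbcast i t = some v) :
    ∃ b rest, (X.midState i t).queue = b :: rest ∧ P.MayAdvance (X.midState i t) t ∧
      v = P.createVertex X.hash X.cert i (X.midState i t) b ∧
      X.state i (t + 1) = { X.midState i t with
        round := (X.midState i t).round + 1, timer := t, queue := rest, own := v } := by
  rw [state_succ]
  unfold rbcast at h
  unfold Protocol.advance at h ⊢
  split at h
  · simp at h
  · next b rest hq =>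
    split at h
    · next hm =>
      rw [if_pos hm]
      dsimp only at h ⊢
      rw [Option.some.injEq] at h
      subst h
      exact ⟨b, rest, hq, hm, rfl, rfl⟩
    · simp at h

theorem Admissible.exists_rbcast (A : X.Admissible Δ G) {i : Fin P.n} (hi : i ∈ X.correct) {t : ℕ}
    (h : P.MayAdvance (X.midState i t) t) : ∃ v, X.rbcast i t = some v := by
  have hq : (X.midState i t).queue ≠ [] := by
    rw [(midState_frame i t).2.2.1]
    exact A.backlog i hi t
  unfold rbcast Protocol.advance
  split
  · next h' => exact absurd h' hq
  · rw [if_pos h]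
    exact ⟨_, rfl⟩

theorem rbcast_round_source {i : Fin P.n} {t : ℕ} {v : Vertex 𝕋 P.n} (h : X.rbcast i t = some v) :
    v.round = (X.state i t).round + 1 ∧ v.source = i := by
  obtain ⟨b, rest, -, -, rfl, -⟩ := rbcast_eq_some h
  rw [← (midState_frame i t).1]
  exact ⟨rfl, rfl⟩

/-! ### Invariants of the states of correct validators -/

variable (X) in
/-- Validator `i` has delivered the acceptable vertex `v` before tick `t`. -/
def DeliveredBefore (i : Fin P.n) (t : ℕ) (v : Vertex 𝕋 P.n) : Prop :=
  P.Acceptable X.hash X.cert v ∧ ∃ t' < t, (v, v.round, v.source) ∈ X.inbox i t'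

theorem DeliveredBefore.mono {i : Fin P.n} {t t' : ℕ} {v : Vertex 𝕋 P.n}
    (h : X.DeliveredBefore i t v) (ht : t ≤ t') : X.DeliveredBefore i t' v :=
  ⟨h.1, h.2.elim fun s hs => ⟨s, hs.1.trans_le ht, hs.2⟩⟩

variable (X) in
/-- The invariants of the state `s` of validator `i` at tick `t`. -/
structure StateInv (i : Fin P.n) (t : ℕ) (s : P.State) : Prop where
  dagInv : Protocol.DagInv X.hash X.cert X.certified s.dag
  orderInv : Protocol.OrderInv s
  of_buffer : ∀ v ∈ s.buffer, X.DeliveredBefore i t v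
  of_dag : ∀ v ∈ s.dag, 1 ≤ v.round → X.DeliveredBefore i t v
  of_delivered : ∀ v, X.DeliveredBefore i t v → v ∈ s.buffer ∨ v ∈ s.dag

theorem StateInv.of_eq {i : Fin P.n} {t : ℕ} {s s' : P.State} (h : StateInv X i t s)
    (h1 : s'.dag = s.dag) (h2 : s'.buffer = s.buffer) (h3 : s'.ordered = s.ordered)
    (h4 : s'.lastOrdered = s.lastOrdered) : StateInv X i t s' where
  dagInv := h1 ▸ h.dagInv
  orderInv := ⟨by rw [h1, h3]; exact h.orderInv.ordered, by rw [h1, h4]; exact h.orderInv.supported,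
    by rw [h1, h3, h4]; exact h.orderInv.last⟩
  of_buffer := by rw [h2]; exact h.of_buffer
  of_dag := by rw [h1]; exact h.of_dag
  of_delivered := by rw [h1, h2]; exact h.of_delivered

namespace Admissible

theorem init_inv (A : X.Admissible Δ G) (i : Fin P.n) : StateInv X i 0 (X.state i 0) := by
  have hg : ∀ v ∈ (P.init i).dag, ∃ j, v = Vertex.genesis j := by
    intro v hv
    obtain ⟨j, -, rfl⟩ := Finset.mem_image.1 hv
    exact ⟨j, rfl⟩
  have hr : ∀ v ∈ (P.init i).dag, v.round = 0 := by
    intro v hv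
    obtain ⟨j, rfl⟩ := hg v hv
    rfl
  refine ⟨⟨fun j => Finset.mem_image_of_mem _ (Finset.mem_univ j), ?_, fun v hv _ => hg v hv, ?_,
    ?_⟩, ⟨?_, ?_, Or.inl rfl⟩, ?_, ?_, ?_⟩
  · intro v hv h
    have := hr v hv
    omega
  · intro v hv
    obtain ⟨j, rfl⟩ := hg v hv
    exact A.certified_genesis j
  · intro v hv u hu
    obtain ⟨j, rfl⟩ := hg v hv
    simp [Vertex.edges] at hu
  · intro v hv
    simp [state, Protocol.init] at hv
  · intro a ha
    have := hr a ha.1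
    have := ha.2.2.1
    omega
  · intro v hv
    simp [state, Protocol.init] at hv
  · intro v hv h
    have := hr v hv
    omega
  · rintro v ⟨-, t', ht', -⟩
    omega

theorem midState_inv_of_state (A : X.Admissible Δ G) {i : Fin P.n} (hi : i ∈ X.correct) {t : ℕ}
    (h : StateInv X i t (X.state i t)) : StateInv X i (t + 1) (X.midState i t) := by
  set new := ((X.inbox i t).filter (fun e => P.Valid X.hash X.cert e.2.1 e.2.2 e.1)).map Prod.fst
    with hnew
  have hnewV : ∀ v ∈ new, X.DeliveredBefore i (t + 1) v := by
    intro v hv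
    obtain ⟨⟨w, r, k⟩, he, rfl⟩ := List.mem_map.1 hv
    obtain ⟨he1, he2⟩ := List.mem_filter.1 he
    have hval : P.Valid X.hash X.cert r k w := by simpa using he2
    refine ⟨hval.acceptable, t, Nat.lt_succ_self t, ?_⟩
    obtain ⟨rfl, rfl⟩ := hval.round_source
    exact he1
  have hcert : ∀ v, X.DeliveredBefore i (t + 1) v → X.certified v.round v.source = some v := by
    rintro v ⟨-, t', -, h'⟩
    exact A.certified_of_deliver i hi t' v _ _ h'
  let s₀ : P.State := { X.state i t with
    queue := (X.state i t).queue ++ X.input i t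
    buffer := (X.state i t).buffer ++ new }
  have hmid : X.midState i t = P.drain s₀ := rfl
  have hbuf : ∀ v ∈ s₀.buffer, X.DeliveredBefore i (t + 1) v := by
    intro v hv
    rcases List.mem_append.1 hv with h' | h'
    · exact (h.of_buffer v h').mono (Nat.le_succ t)
    · exact hnewV v h'
  have hord : Protocol.OrderInv s₀ := ⟨h.orderInv.ordered, h.orderInv.supported, h.orderInv.last⟩
  have h1 := Protocol.OrderInv.drain (s := s₀) h.dagInv hord
    (fun v hv => ⟨(hbuf v hv).1, hcert v (hbuf v hv)⟩)
  have h2 := Protocol.drain_induction (P := P) (V := X.DeliveredBefore i (t + 1))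
    (M := fun s => ∀ v ∈ s.dag, 1 ≤ v.round → X.DeliveredBefore i (t + 1) v) (by
      intro s v hs hv
      by_cases hp : ∀ u ∈ v.edges, u ∈ s.dag
      · rw [Protocol.tryInsert_of_parents s v hp, Protocol.tryCommitting_dag]
        intro u hu hr
        rcases Finset.mem_insert.1 hu with rfl | hu
        · exact hv
        · exact hs u hu hr
      · rwa [Protocol.tryInsert_of_not_parents s v hp]) s₀
    (fun v hv hr => (h.of_dag v hv hr).mono (Nat.le_succ t)) hbuf
  rw [hmid]
  refine ⟨h1.1, h1.2, h2.2, h2.1, ?_⟩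
  rintro v ⟨hv, t', ht', hin⟩
  have hin' : v ∈ s₀.buffer ∨ v ∈ s₀.dag := by
    rcases Nat.lt_succ_iff_lt_or_eq.1 ht' with h' | rfl
    · rcases h.of_delivered v ⟨hv, t', h', hin⟩ with h'' | h''
      · exact Or.inl (List.mem_append_left _ h'')
      · exact Or.inr h''
    · refine Or.inl (List.mem_append_right _ (List.mem_map.2 ⟨_, List.mem_filter.2 ⟨hin, ?_⟩, rfl⟩))
      -- `Acceptable` is by definition validity for the vertex's own round and source, which are
      -- those of this delivery.
      exact decide_eq_true hv
  rcases hin' with h' | h'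
  · exact Protocol.mem_buffer_or_dag_drain h'
  · exact Or.inr (Protocol.subset_dag_drain _ h')

theorem state_inv (A : X.Admissible Δ G) {i : Fin P.n} (hi : i ∈ X.correct) (t : ℕ) :
    StateInv X i t (X.state i t) := by
  induction t with
  | zero => exact A.init_inv i
  | succ t ih =>
    obtain ⟨h1, h2, h3, h4⟩ := state_succ_frame (X := X) i t
    exact (A.midState_inv_of_state hi ih).of_eq h1 h2 h3 h4

theorem midState_inv (A : X.Admissible Δ G) {i : Fin P.n} (hi : i ∈ X.correct) (t : ℕ) :
    StateInv X i (t + 1) (X.midState i t) :=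
  A.midState_inv_of_state hi (A.state_inv hi t)

end Admissible

/-! ### Propagation between the DAGs of correct validators -/

theorem state_dag_subset_midState (i : Fin P.n) (t : ℕ) :
    (X.state i t).dag ⊆ (X.midState i t).dag := by
  intro v hv
  unfold midState Protocol.receive
  exact Protocol.subset_dag_drain _ hv

namespace Admissible

/-- A delivered acceptable vertex is in the DAG when its parents are. -/
theorem mem_dag_of_delivered (A : X.Admissible Δ G) {i : Fin P.n} (hi : i ∈ X.correct) {t : ℕ}
    {v : Vertex 𝕋 P.n} (hv : X.DeliveredBefore i (t + 1) v)
    (hp : ∀ u ∈ v.edges, u ∈ (X.midState i t).dag) : v ∈ (X.midState i t).dag := by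
  rcases (A.midState_inv hi t).of_delivered v hv with h | h
  · exact absurd hp (Protocol.drain_stable _ v h)
  · exact h

/-- What is in the DAG of a correct validator is soon in the DAG of every correct validator. -/
theorem dag_transfer (A : X.Admissible Δ G) {i j : Fin P.n} (hi : i ∈ X.correct)
    (hj : j ∈ X.correct) {t y : ℕ} (hy : max t X.gst + Δ ≤ y) :
    (X.midState i t).dag ⊆ (X.midState j y).dag := by
  -- Induction on the round, since parents have to enter first. The delays do not add up: validator
  -- `i` had delivered the whole history by tick `t`, so one deadline serves all of it.
  have key : ∀ r : ℕ, ∀ v ∈ (X.midState i t).dag, v.round = r → v ∈ (X.midState j y).dag := by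
    intro r
    induction r using Nat.strong_induction_on with
    | _ r ih =>
      intro v hv hr
      have I := (A.midState_inv hi t).dagInv
      rcases Nat.eq_zero_or_pos v.round with h0 | h0
      · obtain ⟨k, rfl⟩ := I.eq_genesis v hv h0
        exact (A.midState_inv hj y).dagInv.genesis_mem k
      · obtain ⟨ha, t', ht', hin⟩ := (A.midState_inv hi t).of_dag v hv h0
        obtain ⟨t'', h1, h2⟩ := A.agreement i hi t' v _ _ hin j hj
        refine A.mem_dag_of_delivered hj ⟨ha, t'', by omega, h2⟩ fun u hu => ?_
        have := I.edges_round hv hu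
        exact ih u.round (by omega) u (I.closed v hv u hu) rfl
  exact fun v hv => key _ v hv rfl

end Admissible

end Execution
end SparseBullshark

namespace SparseBullshark
open scoped Classical

namespace Execution
variable {𝕋 : Alphabet} {P : Protocol 𝕋} {X : Execution P} {Δ G : ℕ}

/-! ### Rounds and the ticks at which they are entered -/

theorem round_succ_of_rbcast_eq_none {i : Fin P.n} {t : ℕ} (h : X.rbcast i t = none) :
    (X.state i (t + 1)).round = (X.state i t).round := by
  rw [state_succ_of_rbcast_eq_none h, (midState_frame i t).1]

theorem round_succ_of_rbcast_eq_some {i : Fin P.n} {t : ℕ} {v : Vertex 𝕋 P.n}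
    (h : X.rbcast i t = some v) : (X.state i (t + 1)).round = (X.state i t).round + 1 := by
  obtain ⟨b, rest, -, -, -, hs⟩ := rbcast_eq_some h
  rw [hs]
  exact congrArg (· + 1) (midState_frame i t).1

theorem round_le_succ (i : Fin P.n) (t : ℕ) :
    (X.state i t).round ≤ (X.state i (t + 1)).round := by
  cases h : X.rbcast i t with
  | none => exact (round_succ_of_rbcast_eq_none h).ge
  | some v => rw [round_succ_of_rbcast_eq_some h]; omega

theorem round_mono (i : Fin P.n) : Monotone fun t => (X.state i t).round :=
  monotone_nat_of_le_succ (round_le_succ i)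

variable (X) in
/-- The tick at which validator `i` enters round `q`, if it does. -/
noncomputable def entry (i : Fin P.n) (q : ℕ) : ℕ := sInf {t | q ≤ (X.state i (t + 1)).round}

variable (X) in
/-- Validator `i` enters round `q` at some time. -/
def Reaches (i : Fin P.n) (q : ℕ) : Prop := ∃ t, q ≤ (X.state i (t + 1)).round

theorem entry_le {i : Fin P.n} {q t : ℕ} (h : q ≤ (X.state i (t + 1)).round) : X.entry i q ≤ t :=
  Nat.sInf_le h

/-- `Reaches` excludes the default value 0 of `sInf` on the empty set. The inequality is strict
because `state i t` is the state before tick `t` is processed. -/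
theorem Reaches.le_round {i : Fin P.n} {q t : ℕ} (h : X.Reaches i q) (ht : X.entry i q < t) :
    q ≤ (X.state i t).round := by
  have h1 : q ≤ (X.state i (X.entry i q + 1)).round := Nat.sInf_mem h
  exact h1.trans (round_mono i ht)

theorem entry_zero (i : Fin P.n) : X.entry i 0 = 0 :=
  Nat.le_zero.1 (entry_le (Nat.zero_le _))

theorem Reaches.of_le {i : Fin P.n} {q q' : ℕ} (h : X.Reaches i q) (hq : q' ≤ q) :
    X.Reaches i q' := h.elim fun t ht => ⟨t, hq.trans ht⟩

/-- Rounds rise by at most one per tick, so the first tick that attains round `q` is an advance from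
exactly `q - 1`. -/
theorem Reaches.rbcast_entry {i : Fin P.n} {q : ℕ} (h : X.Reaches i q) (hq : 1 ≤ q) :
    (X.state i (X.entry i q)).round + 1 = q ∧
      ∃ v, X.rbcast i (X.entry i q) = some v ∧ v.round = q ∧ v.source = i := by
  have h1 : q ≤ (X.state i (X.entry i q + 1)).round := h.le_round (Nat.lt_succ_self _)
  have h2 : (X.state i (X.entry i q)).round < q := by
    by_contra hc
    push Not at hc
    rcases Nat.eq_zero_or_pos (X.entry i q) with h0 | h0
    · rw [h0] at hc
      change q ≤ 0 at hc
      omega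
    · obtain ⟨k, hk⟩ := Nat.exists_eq_add_of_lt h0
      rw [hk] at hc
      have := entry_le hc
      omega
  cases hr : X.rbcast i (X.entry i q) with
  | none =>
    rw [round_succ_of_rbcast_eq_none hr] at h1
    omega
  | some v =>
    obtain ⟨h3, h4⟩ := rbcast_round_source hr
    rw [round_succ_of_rbcast_eq_some hr] at h1
    exact ⟨by omega, v, rfl, by omega, h4⟩

theorem entry_eq_of_rbcast {i : Fin P.n} {t : ℕ} {v : Vertex 𝕋 P.n} (h : X.rbcast i t = some v) :
    X.Reaches i v.round ∧ X.entry i v.round = t := by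
  obtain ⟨h1, -⟩ := rbcast_round_source h
  have h2 := round_succ_of_rbcast_eq_some h
  have h3 : X.Reaches i v.round := ⟨t, by omega⟩
  refine ⟨h3, le_antisymm (entry_le (by omega)) ?_⟩
  by_contra hc
  push Not at hc
  have := h3.le_round hc
  omega

/-- At most one advance per tick. Round 0 is excluded because both it and round 1 can have entry
tick 0. -/
theorem Reaches.entry_lt {i : Fin P.n} {q : ℕ} (h : X.Reaches i (q + 1)) (hq : 1 ≤ q) :
    X.entry i q < X.entry i (q + 1) := by
  obtain ⟨h1, -⟩ := h.rbcast_entry (by omega)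
  by_contra hc
  push Not at hc
  have h2 := round_mono (X := X) i hc
  have h3 := ((h.of_le (Nat.le_succ q)).rbcast_entry hq).1
  dsimp only at h2
  omega

/-- The timer and the last own vertex, in terms of the tick of the last round entry. -/
theorem timer_own (i : Fin P.n) (t : ℕ) :
    (X.state i t).timer = X.entry i (X.state i t).round ∧
    ((X.state i t).round = 0 → (X.state i t).own = Vertex.genesis i) ∧
    (1 ≤ (X.state i t).round → X.entry i (X.state i t).round < t ∧
      X.rbcast i (X.entry i (X.state i t).round) = some (X.state i t).own) := by
  induction t with
  | zero => exact ⟨(entry_zero i).symm, fun _ => rfl, fun h => absurd h (by simp [state, Protocol.init])⟩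
  | succ t ih =>
    cases h : X.rbcast i t with
    | none =>
      have hr := round_succ_of_rbcast_eq_none h
      rw [hr, state_succ_of_rbcast_eq_none h, (midState_frame i t).2.1, (midState_frame i t).2.2.2]
      exact ⟨ih.1, ih.2.1, fun h' => ⟨(ih.2.2 h').1.trans (Nat.lt_succ_self t), (ih.2.2 h').2⟩⟩
    | some v =>
      have hr := round_succ_of_rbcast_eq_some h
      have hv := (rbcast_round_source h).1
      have he := (entry_eq_of_rbcast h).2
      rw [hr, ← hv, he]
      obtain ⟨b, rest, -, -, -, hs⟩ := rbcast_eq_some h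
      rw [hs]
      exact ⟨rfl, fun h0 => absurd h0 (by omega), fun _ => ⟨Nat.lt_succ_self t, h⟩⟩

theorem own_round_source (i : Fin P.n) (t : ℕ) :
    (X.state i t).own.round = (X.state i t).round ∧ (X.state i t).own.source = i := by
  obtain ⟨-, h0, h1⟩ := timer_own (X := X) i t
  rcases Nat.eq_zero_or_pos (X.state i t).round with h | h
  · rw [h0 h, h]
    exact ⟨rfl, rfl⟩
  · have hR : X.Reaches i (X.state i t).round := ⟨t, round_le_succ i t⟩
    obtain ⟨-, v, hv, h2, h3⟩ := hR.rbcast_entry h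
    have := hv.symm.trans (h1 h).2
    rw [Option.some.injEq] at this
    rw [← this]
    exact ⟨h2, h3⟩

/-! ### Blocks -/

theorem broadcasts_succ (i : Fin P.n) (t : ℕ) :
    X.broadcasts i (t + 1) = X.broadcasts i t ++ X.input i (t + 1) := by
  unfold broadcasts
  rw [List.range_succ (n := t + 1), List.flatMap_append]
  simp

theorem broadcasts_prefix (i : Fin P.n) {t t' : ℕ} (h : t ≤ t') :
    X.broadcasts i t <+: X.broadcasts i t' := by
  induction h with
  | refl => exact List.prefix_rfl
  | step _ ih =>
    refine ih.trans ?_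
    rw [broadcasts_succ]
    exact List.prefix_append _ _

/-- Each advance consumes exactly one block, so the queue is the input so far without its first
`round` entries. This ties the round of a vertex to the sequence number of its block. -/
theorem midState_queue (i : Fin P.n) (t : ℕ) :
    (X.midState i t).queue = (X.broadcasts i t).drop (X.state i t).round ∧
      (X.state i t).round ≤ (X.broadcasts i t).length := by
  induction t with
  | zero =>
    rw [(midState_frame i 0).2.2.1]
    simp [state, Protocol.init, broadcasts]
  | succ t ih =>
    have hsucc : (X.state i (t + 1)).queue = (X.broadcasts i t).drop (X.state i (t + 1)).round ∧
        (X.state i (t + 1)).round ≤ (X.broadcasts i t).length := by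
      cases h : X.rbcast i t with
      | none =>
        rw [state_succ_of_rbcast_eq_none h, (midState_frame i t).1]
        exact ih
      | some v =>
        rw [round_succ_of_rbcast_eq_some h]
        obtain ⟨b, rest, hq, -, -, hs⟩ := rbcast_eq_some h
        rw [hs]
        rw [hq] at ih
        refine ⟨?_, ?_⟩
        · rw [← List.drop_drop, ← ih.1]
          rfl
        · have := congrArg List.length ih.1
          rw [List.length_cons, List.length_drop] at this
          omega
    rw [(midState_frame i (t + 1)).2.2.1, broadcasts_succ, hsucc.1,
      List.drop_append_of_le_length hsucc.2]
    refine ⟨rfl, ?_⟩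
    rw [List.length_append]
    omega

theorem rbcast_block {i : Fin P.n} {t : ℕ} {v : Vertex 𝕋 P.n} (h : X.rbcast i t = some v) :
    ∃ b, v.block = some b ∧ (X.broadcasts i t)[v.round - 1]? = some b := by
  have hr := (rbcast_round_source h).1
  obtain ⟨b, rest, hq, -, hv, -⟩ := rbcast_eq_some h
  refine ⟨b, by rw [hv]; rfl, ?_⟩
  rw [(midState_queue i t).1] at hq
  rw [hr, Nat.add_sub_cancel, ← Nat.add_zero (X.state i t).round, ← List.getElem?_drop, hq]
  rfl

/-- The lists of broadcasts at different ticks are prefixes of one another, so an index determines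
the block. -/
theorem ABcast.eq {i : Fin P.n} {m b : 𝕋.Block} {s t : ℕ} (h : X.ABcast i m s)
    (hb : (X.broadcasts i t)[s - 1]? = some b) : m = b := by
  obtain ⟨-, t', ht'⟩ := h
  have h1 := (List.prefix_iff_getElem?.1 (broadcasts_prefix (X := X) i (le_max_left t t')))
  have h2 := (List.prefix_iff_getElem?.1 (broadcasts_prefix (X := X) i (le_max_right t t')))
  obtain ⟨l1, e1⟩ := List.getElem?_eq_some_iff.1 hb
  obtain ⟨l2, e2⟩ := List.getElem?_eq_some_iff.1 ht'
  have h3 := h1 _ l1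
  have h4 := h2 _ l2
  rw [h3, Option.some.injEq] at h4
  rw [← e1, ← e2, h4]

end Execution

/-! ### Vertices created by correct validators -/

namespace Protocol
variable {𝕋 : Alphabet} {P : Protocol 𝕋} {hash : 𝕋.Comm → P.Seed} {cert : Vertex 𝕋 P.n → 𝕋.Cert}
  {cf : ℕ → Fin P.n → Option (Vertex 𝕋 P.n)} {dag : Finset (Vertex 𝕋 P.n)}

theorem mem_entries {a : Fin P.n → Option (Ref 𝕋 P.n)} {x : Ref 𝕋 P.n} :
    x ∈ P.entries a ↔ ∃ i, a i = some x := by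
  unfold entries
  simp

theorem mem_entries_refArray {r : ℕ} {x : Ref 𝕋 P.n} (h : x ∈ P.entries (P.refArray cert dag r)) :
    x.1 ∈ P.layer dag r ∧ x = (x.1, cert x.1) ∧ P.refArray cert dag r x.1.source = some x := by
  obtain ⟨i, hi⟩ := mem_entries.1 h
  have hi' := hi
  unfold refArray at hi
  rw [Option.map_eq_some_iff] at hi
  obtain ⟨v, hv, rfl⟩ := hi
  obtain ⟨h1, h2, rfl⟩ := mem_of_lookup hv
  exact ⟨Finset.mem_filter.2 ⟨h1, h2⟩, rfl, hi'⟩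

/-- Guarantees that a layer large enough for advancing yields an array with the `n_p` entries that
ALBA requires: attaching certificates is injective, and each vertex of the layer is found under its
source. -/
theorem DagInv.card_layer_le (I : DagInv hash cert cf dag) (r : ℕ) :
    (P.layer dag r).card ≤ (P.entries (P.refArray cert dag r)).card := by
  refine Finset.card_le_card_of_injOn (fun v => (v, cert v)) ?_ ?_
  · intro v hv
    obtain ⟨h1, h2⟩ := Finset.mem_filter.1 (Finset.mem_coe.1 hv)
    refine Finset.mem_coe.2 (mem_entries.2 ⟨v.source, ?_⟩)
    unfold refArray
    rw [I.lookup_eq h1 h2 rfl]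
    rfl
  · intro v _ w _ h
    exact (Prod.mk.inj h).1

end Protocol

namespace Execution
variable {𝕋 : Alphabet} {P : Protocol 𝕋} {X : Execution P} {Δ G : ℕ}

theorem Admissible.two_mul_f_lt_card_entries (A : X.Admissible Δ G) {i : Fin P.n}
    (hi : i ∈ X.correct) {t : ℕ} {v : Vertex 𝕋 P.n} (h : X.rbcast i t = some v) :
    2 * P.f + 1 ≤ (P.entries (X.array i t)).card := by
  obtain ⟨b, rest, -, hm, -, -⟩ := rbcast_eq_some h
  exact hm.1.trans ((A.midState_inv hi t).dagInv.card_layer_le _)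

theorem rbcast_edges_eq {i : Fin P.n} {t : ℕ} {v : Vertex 𝕋 P.n} (h : X.rbcast i t = some v) :
    v.edges = (P.drawSample X.hash (X.array i t)).map Prod.fst ++ (X.state i t).own ::
      (P.getAnchor (X.midState i t).dag (X.state i t).round).toList := by
  obtain ⟨b, rest, -, -, rfl, -⟩ := rbcast_eq_some h
  rw [← (midState_frame i t).1, ← (midState_frame i t).2.2.2]
  rfl

/-- The edges of a vertex created by a correct validator. -/
theorem Admissible.rbcast_edges (A : X.Admissible Δ G) {i : Fin P.n} (hi : i ∈ X.correct) {t : ℕ}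
    {v : Vertex 𝕋 P.n} (h : X.rbcast i t = some v) {u : Vertex 𝕋 P.n} (hu : u ∈ v.edges) :
    u.round + 1 = v.round ∧ (u = (X.state i t).own ∨ u ∈ (X.midState i t).dag) := by
  rw [(rbcast_round_source h).1, Nat.add_right_cancel_iff]
  rw [rbcast_edges_eq h, List.mem_append, List.mem_cons] at hu
  rcases hu with hu | rfl | hu
  · obtain ⟨x, hx, rfl⟩ := List.mem_map.1 hu
    have hx' := P.alba.prove_mem _ _ (A.two_mul_f_lt_card_entries hi h) x hx
    obtain ⟨h1, -, -⟩ := Protocol.mem_entries_refArray hx'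
    obtain ⟨h2, h3⟩ := Finset.mem_filter.1 h1
    exact ⟨h3.trans (midState_frame i t).1, Or.inr h2⟩
  · exact ⟨(own_round_source i t).1, Or.inl rfl⟩
  · rw [Option.mem_toList] at hu
    obtain ⟨h1, h2, -, -⟩ := Protocol.mem_of_getAnchor hu
    exact ⟨h2, Or.inr h1⟩

/-- A vertex created by a correct validator is acceptable if ALBA is complete for its sample. -/
theorem Admissible.acceptable_of_rbcast (A : X.Admissible Δ G) {i : Fin P.n} (hi : i ∈ X.correct)
    {t : ℕ} {v : Vertex 𝕋 P.n} (h : X.rbcast i t = some v)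
    (hv : P.alba.verify (X.hash (P.vc.commit (X.array i t)))
      (P.alba.prove (X.hash (P.vc.commit (X.array i t))) (P.entries (X.array i t))) = true) :
    P.Acceptable X.hash X.cert v := by
  have hedges := fun u => A.rbcast_edges hi h (u := u)
  have hcard := A.two_mul_f_lt_card_entries hi h
  have hlen : v.edges.length ≤ P.D + 2 := by
    rw [rbcast_edges_eq h, List.length_append, List.length_map, List.length_cons]
    have h1 : (P.drawSample X.hash (X.array i t)).length = P.D := P.alba.prove_length _ _ hcard
    have h2 : (P.getAnchor (X.midState i t).dag (X.state i t).round).toList.length ≤ 1 := by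
      cases P.getAnchor (X.midState i t).dag (X.state i t).round <;> simp
    omega
  have hmem : ∀ x ∈ P.drawSample X.hash (X.array i t), x = (x.1, X.cert x.1) ∧
      X.array i t x.1.source = some x := fun x hx =>
    (Protocol.mem_entries_refArray (P.alba.prove_mem _ _ hcard x hx)).2
  obtain ⟨b, rest, -, -, hve, -⟩ := rbcast_eq_some h
  have hve' : v = Vertex.node ((X.midState i t).round + 1) i b
      ((P.drawSample X.hash (X.array i t)).map Prod.fst)
      ((X.midState i t).own :: (P.getAnchor (X.midState i t).dag (X.midState i t).round).toList)
      (P.vc.commit (X.array i t)) ((P.drawSample X.hash (X.array i t)).map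
        (fun x => P.vc.proof (X.array i t) x.1.source)) := hve
  clear hve
  subst hve'
  refine ⟨rfl, rfl, (List.toFinset_card_le _).trans hlen, fun u hu => (hedges u hu).1, ?_, ?_⟩
  · rw [List.forall₂_map_left_iff, List.forall₂_map_right_iff, List.forall₂_same]
    intro x hx
    obtain ⟨h1, h2⟩ := hmem x hx
    rw [← h1, ← h2]
    exact P.vc.correct _ _
  · rw [List.map_map]
    -- The sampled references carry the certificates given by `cert`, so dropping the certificates
    -- and attaching them again changes nothing.
    have : (P.drawSample X.hash (X.array i t)).map ((fun u => (u, X.cert u)) ∘ Prod.fst) =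
        P.drawSample X.hash (X.array i t) := by
      conv_rhs => rw [← List.map_id (P.drawSample X.hash (X.array i t))]
      exact List.map_congr_left fun x hx => (hmem x hx).1.symm
    rw [this]
    exact hv

end Execution
end SparseBullshark

namespace SparseBullshark
open scoped Classical

namespace Protocol
variable {𝕋 : Alphabet} {P : Protocol 𝕋} {hash : 𝕋.Comm → P.Seed} {cert : Vertex 𝕋 P.n → 𝕋.Cert}
  {cf : ℕ → Fin P.n → Option (Vertex 𝕋 P.n)} {dag dag' : Finset (Vertex 𝕋 P.n)}

/-! ### Advancing without the timeout -/

variable (P) in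
/-- The condition under which a validator in round `q` may advance before the timeout. -/
def Quick (dag : Finset (Vertex 𝕋 P.n)) (q : ℕ) : Prop :=
  if q % 2 = 0 then (P.getAnchor dag q).isSome = true
  else
    2 * P.f + 1 ≤ ((P.layer dag q).filter
      (fun v => ∃ a ∈ P.getAnchor dag (q - 1), a ∈ v.edges)).card ∨
    P.f + 1 ≤ ((P.layer dag q).filter
      (fun v => ¬ ∃ a ∈ P.getAnchor dag (q - 1), a ∈ v.edges)).card

theorem mayAdvance_iff (s : P.State) (now : ℕ) : P.MayAdvance s now ↔
    2 * P.f + 1 ≤ (P.layer s.dag s.round).card ∧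
      (s.timer + P.timeout ≤ now ∨ P.Quick s.dag s.round) := Iff.rfl

theorem DagInv.getAnchor_mono (I' : DagInv hash cert cf dag') (hd : dag ⊆ dag') {q : ℕ}
    {a : Vertex 𝕋 P.n} (h : P.getAnchor dag q = some a) : P.getAnchor dag' q = some a := by
  obtain ⟨h1, h2, h3, h4⟩ := mem_of_getAnchor h
  exact I'.getAnchor_eq (hd h1) h2 h3 h4

theorem layer_mono (hd : dag ⊆ dag') (q : ℕ) : P.layer dag q ⊆ P.layer dag' q :=
  Finset.filter_subset_filter _ hd

/-- The delicate case is the negative one, counting vertices that do not reference the anchor. A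
vertex of the smaller DAG that references the anchor has it as a parent, so the anchor is already
there and no such vertex changes sides. -/
theorem Quick.mono (I : DagInv hash cert cf dag) (I' : DagInv hash cert cf dag') (hd : dag ⊆ dag')
    {q : ℕ} (h : P.Quick dag q) : P.Quick dag' q := by
  unfold Quick at h ⊢
  split at h
  · next hq =>
    rw [if_pos hq]
    obtain ⟨a, ha⟩ := Option.isSome_iff_exists.1 h
    rw [I'.getAnchor_mono hd ha]
    rfl
  · next hq =>
    rw [if_neg hq]
    refine h.imp (fun h => h.trans (Finset.card_le_card ?_))
      (fun h => h.trans (Finset.card_le_card ?_))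
    · intro v hv
      obtain ⟨h1, a, h2, h3⟩ := Finset.mem_filter.1 hv
      exact Finset.mem_filter.2 ⟨layer_mono hd q h1, a, I'.getAnchor_mono hd h2, h3⟩
    · intro v hv
      obtain ⟨h1, h2⟩ := Finset.mem_filter.1 hv
      refine Finset.mem_filter.2 ⟨layer_mono hd q h1, fun ⟨a, h3, h4⟩ => h2 ⟨a, ?_, h4⟩⟩
      obtain ⟨-, h6, h7, h8⟩ := mem_of_getAnchor h3
      exact I.getAnchor_eq (I.closed v (Finset.mem_filter.1 h1).1 a h4) h6 h7 h8

end Protocol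

namespace Execution
variable {𝕋 : Alphabet} {P : Protocol 𝕋} {X : Execution P} {Δ G : ℕ}

/-! ### Consequences of the soundness of sampling -/

variable (X) in
/-- Up to tick `H`, the samples of correct validators are acceptable. -/
def Complete (H : ℕ) : Prop :=
  ∀ i ∈ X.correct, ∀ t ≤ H, ∀ v, X.rbcast i t = some v → P.Acceptable X.hash X.cert v

variable (X) in
/-- Up to tick `H`, all vertices two rounds above a supported anchor sample one of its supporters. -/
def Sound (H : ℕ) : Prop :=
  ∀ j ∈ X.correct, ∀ t ≤ H, ∀ a, P.Supported (X.midState j t).dag a →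
    ∀ w ∈ (X.midState j t).dag, w.round = a.round + 2 → ∃ u ∈ w.sample, a ∈ u.edges

/-- `Sound` settles vertices exactly two rounds above the anchor. From higher ones, descend along
any sampled vertex; one exists since accepted samples have length `D ≥ 1`. -/
theorem Admissible.reach_supported (A : X.Admissible Δ G) {H : ℕ} (hS : X.Sound H) {j : Fin P.n}
    (hj : j ∈ X.correct) {t : ℕ} (ht : t ≤ H) {a : Vertex 𝕋 P.n}
    (ha : P.Supported (X.midState j t).dag a) {w : Vertex 𝕋 P.n}
    (hw : w ∈ (X.midState j t).dag) (hr : a.round + 2 ≤ w.round) : Reach w a := by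
  have I := (A.midState_inv hj t).dagInv
  have key : ∀ d : ℕ, ∀ w ∈ (X.midState j t).dag, w.round = a.round + 2 + d → Reach w a := by
    intro d
    induction d with
    | zero =>
      intro w hw hr
      obtain ⟨u, hu, hau⟩ := hS j hj t ht a ha w hw hr
      have hu' := w.sample_subset_edges u hu
      have := I.edges_round hw hu'
      exact (Relation.ReflTransGen.single ⟨hu', by omega⟩).tail ⟨hau, ha.2.2.1⟩
    | succ d ih =>
      intro w hw hr
      obtain ⟨u, hu⟩ := (I.acceptable w hw (by omega)).exists_sample
      have hu' := w.sample_subset_edges u hu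
      have := I.edges_round hw hu'
      exact (ih u (I.closed w hw u hu') (by omega)).head ⟨hu', by omega⟩
  exact key (w.round - (a.round + 2)) w hw (by omega)

/-- The last directly ordered anchor is not below `a`, and it reaches `a` if it is above, so its
ordered history contains that of `a`. -/
theorem Admissible.ordered_of_supported (A : X.Admissible Δ G) {H : ℕ} (hS : X.Sound H)
    {j : Fin P.n} (hj : j ∈ X.correct) {t : ℕ} (ht : t ≤ H) {a v : Vertex 𝕋 P.n}
    (ha : P.Supported (X.midState j t).dag a) (hv : Reach a v) :
    v ∈ (X.midState j t).ordered := by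
  have hI := A.midState_inv hj t
  have h1 := hI.orderInv.supported a ha
  have h2 := ha.2.2.1
  rcases hI.orderInv.last with h | ⟨b, hb, hbr, hbo⟩
  · omega
  · rcases Nat.lt_or_ge a.round b.round with h3 | h3
    -- Anchors live in even rounds, so strictly above means at least two rounds above.
    · have h4 := ha.2.1
      have h5 := hb.2.1
      exact hbo v ((A.reach_supported hS hj ht ha hb.1 (by omega)).trans hv)
    · have : a = b := by
        refine hI.dagInv.unique ha.1 hb.1 (by omega) ?_
        rw [ha.2.2.2.1, hb.2.2.2.1]
        congr 1
        omega
      exact hbo v (this ▸ hv)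

/-- The supported anchor responsible for the delivery is still supported in the other DAG after Δ,
and there its history is ordered. -/
theorem Admissible.agreement_of_sound (A : X.Admissible Δ G) {H τ : ℕ} (hS : X.Sound H)
    (hH : max τ X.gst + Δ ≤ H) : X.Agreement τ := by
  rintro i hi m s k ⟨v, hv, hm⟩ j hj
  obtain ⟨-, a, ha, hav⟩ := (A.state_inv hi τ).orderInv.ordered v hv
  refine ⟨max τ X.gst + Δ + 1, v, ?_, hm⟩
  rw [(state_succ_frame j _).2.2.1]
  exact A.ordered_of_supported hS hj hH (ha.mono
    ((state_dag_subset_midState i τ).trans (A.dag_transfer hi hj le_rfl))) hav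

/-! ### Liveness -/

/-- A vertex created by a correct validator is soon in the DAG of every correct validator. -/
theorem Admissible.mem_dag_of_rbcast (A : X.Admissible Δ G) {H : ℕ} (hC : X.Complete H)
    {i j : Fin P.n} (hi : i ∈ X.correct) (hj : j ∈ X.correct) {t y : ℕ} {v : Vertex 𝕋 P.n}
    (ht : t ≤ H) (h : X.rbcast i t = some v) (hy : max t X.gst + Δ ≤ y) :
    v ∈ (X.midState j y).dag := by
  -- The own predecessor is the one parent that need not yet be in the creator's DAG. It was
  -- broadcast earlier, so it is handled by induction; the other parents come by `dag_transfer`.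
  induction t using Nat.strong_induction_on generalizing v with
  | _ t ih =>
    obtain ⟨t', ht', hin⟩ := A.validity i hi t v h j hj
    refine A.mem_dag_of_delivered hj ⟨hC i hi t ht v h, t', by omega, ?_⟩ fun u hu => ?_
    · rwa [(rbcast_round_source h).2]
    · rcases (A.rbcast_edges hi h hu).2 with rfl | hu'
      · obtain ⟨-, h0, h1⟩ := timer_own (X := X) i t
        rcases Nat.eq_zero_or_pos (X.state i t).round with hr | hr
        · rw [h0 hr]
          exact (A.midState_inv hj y).dagInv.genesis_mem i
        · obtain ⟨h2, h3⟩ := h1 hr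
          exact ih _ h2 (by omega) h3 (by omega)
      · exact A.dag_transfer hi hj hy hu'

theorem Admissible.le_card_of_sources (A : X.Admissible Δ G) {S : Finset (Vertex 𝕋 P.n)}
    (h : ∀ j ∈ X.correct, ∃ v ∈ S, v.source = j) : 2 * P.f + 1 ≤ S.card := by
  have : X.correct ⊆ S.image Vertex.source := fun j hj => by
    obtain ⟨v, hv, hs⟩ := h j hj
    exact Finset.mem_image.2 ⟨v, hv, hs⟩
  exact A.card_correct.trans ((Finset.card_le_card this).trans Finset.card_image_le)

theorem Reaches.quick {i : Fin P.n} {q : ℕ} (h : X.Reaches i (q + 1)) :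
    2 * P.f + 1 ≤ (P.layer (X.midState i (X.entry i (q + 1))).dag q).card ∧
      (X.entry i q + P.timeout ≤ X.entry i (q + 1) ∨
        P.Quick (X.midState i (X.entry i (q + 1))).dag q) := by
  obtain ⟨h1, v, hv, -, -⟩ := h.rbcast_entry (by omega)
  obtain ⟨-, -, -, hm, -, -⟩ := rbcast_eq_some hv
  rw [Protocol.mayAdvance_iff, (midState_frame i _).1, (midState_frame i _).2.1,
    (timer_own i _).1] at hm
  have hq : (X.state i (X.entry i (q + 1))).round = q := by omega
  rwa [hq] at hm

/-- By tick `y` the validator has either left round `q` already, or it is still there and the guard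
holds; the backlog of blocks then lets it advance. For `q = 0` no strict inequality is needed, since
round 0 is the initial state. -/
theorem Admissible.entry_succ_le (A : X.Admissible Δ G) {i : Fin P.n} (hi : i ∈ X.correct)
    {q y : ℕ} (hR : X.Reaches i q) (hy : q = 0 ∨ X.entry i q < y)
    (h1 : 2 * P.f + 1 ≤ (P.layer (X.midState i y).dag q).card)
    (h2 : X.entry i q + P.timeout ≤ y ∨ P.Quick (X.midState i y).dag q) :
    X.Reaches i (q + 1) ∧ X.entry i (q + 1) ≤ y := by
  have hge : q ≤ (X.state i y).round := by
    rcases hy with rfl | hy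
    · exact Nat.zero_le _
    · exact hR.le_round hy
  have hlt : q + 1 ≤ (X.state i (y + 1)).round := by
    rcases hge.lt_or_eq with h | h
    · exact h.trans_le (round_le_succ i y)
    · have hm : P.MayAdvance (X.midState i y) y := by
        rw [Protocol.mayAdvance_iff, (midState_frame i y).1, (midState_frame i y).2.1,
          (timer_own i y).1, ← h]
        exact ⟨h1, h2⟩
      obtain ⟨v, hv⟩ := A.exists_rbcast hi hm
      rw [round_succ_of_rbcast_eq_some hv, h]
  exact ⟨⟨y, hlt⟩, entry_le hlt⟩

/-- All correct validators have entered round `q` by tick `gst + q * timeout`. -/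
theorem Admissible.reaches (A : X.Admissible Δ G) {H : ℕ} (hC : X.Complete H) (hΔ : 1 ≤ Δ)
    (hT : 2 * Δ ≤ P.timeout) (q : ℕ) (hq : X.gst + q * P.timeout ≤ H) :
    ∀ i ∈ X.correct, X.Reaches i q ∧ X.entry i q ≤ X.gst + q * P.timeout := by
  induction q with
  | zero =>
    intro i _
    exact ⟨⟨0, Nat.zero_le _⟩, by rw [entry_zero]; exact Nat.zero_le _⟩
  | succ q ih =>
    intro i hi
    rw [Nat.succ_mul] at hq ⊢
    have ih' := ih (by omega)
    obtain ⟨h1, h2⟩ := ih' i hi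
    -- One timeout per round suffices: the local timer has expired, and the round-`q` vertices of
    -- all correct validators, created by tick `gst + q * timeout`, have arrived because Δ is below
    -- the timeout.
    refine A.entry_succ_le hi h1 (Or.inr (by omega)) ?_ (Or.inl (by omega))
    apply A.le_card_of_sources
    intro j hj
    obtain ⟨h3, h4⟩ := ih' j hj
    rcases Nat.eq_zero_or_pos q with rfl | hq0
    · exact ⟨Vertex.genesis j, Finset.mem_filter.2
        ⟨(A.midState_inv hi _).dagInv.genesis_mem j, rfl⟩, rfl⟩
    · obtain ⟨-, v, hv, hr, hs⟩ := h3.rbcast_entry hq0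
      exact ⟨v, Finset.mem_filter.2
        ⟨A.mem_dag_of_rbcast hC hj hi (by omega) hv (by omega), hr⟩, hs⟩

/-! ### The lag of a correct validator -/

/-- What let `i` leave round `q` is visible to `k` after Δ, except for an expired timer, which is
local; in that case `k` waits for its own timer, but `i` has also spent a full timeout in the round.
-/
theorem Admissible.catch_up (A : X.Admissible Δ G) {k i : Fin P.n} (hk : k ∈ X.correct)
    (hi : i ∈ X.correct) {q : ℕ} (hRk : X.Reaches k q) (hRi : X.Reaches i (q + 1))
    (hT : 1 ≤ P.timeout) :
    X.entry k (q + 1) ≤ max (X.entry k q + 1) (max (X.entry i (q + 1)) X.gst + Δ) ∨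
      X.entry i q + P.timeout ≤ X.entry i (q + 1) ∧ X.entry k (q + 1) ≤
        max (X.entry k q + P.timeout) (max (X.entry i (q + 1)) X.gst + Δ) := by
  obtain ⟨h1, h2⟩ := hRi.quick
  have hlayer : ∀ y, max (X.entry i (q + 1)) X.gst + Δ ≤ y →
      2 * P.f + 1 ≤ (P.layer (X.midState k y).dag q).card := fun y hy =>
    h1.trans (Finset.card_le_card (Protocol.layer_mono (A.dag_transfer hi hk hy) q))
  rcases h2 with h2 | h2
  · exact Or.inr ⟨h2, (A.entry_succ_le hk hRk (Or.inr (by omega)) (hlayer _ (le_max_right _ _))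
      (Or.inl (le_max_left _ _))).2⟩
  · exact Or.inl (A.entry_succ_le hk hRk (Or.inr (by omega)) (hlayer _ (le_max_right _ _))
      (Or.inr (h2.mono (A.midState_inv hi _).dagInv (A.midState_inv hk _).dagInv
        (A.dag_transfer hi hk (le_max_right _ _))))).2

/-- An anchor of a correct leader in the DAG of a correct validator is the one that the leader has
created before. -/
theorem Admissible.anchor_of_correct (A : X.Admissible Δ G) {k i : Fin P.n} (hk : k ∈ X.correct)
    (hi : i ∈ X.correct) {q t : ℕ} (hq : 1 ≤ q) (hl : P.leader q = k) {a : Vertex 𝕋 P.n}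
    (ha : P.getAnchor (X.midState i t).dag q = some a) :
    X.entry k q < t ∧ X.rbcast k (X.entry k q) = some a := by
  obtain ⟨h1, rfl, h3, -⟩ := Protocol.mem_of_getAnchor ha
  obtain ⟨-, t', ht', hin⟩ := (A.midState_inv hi t).of_dag a h1 hq
  rw [h3, hl] at hin
  obtain ⟨-, t'', h4, h5⟩ := A.no_creation i hi k hk t' a _ hin
  rw [(entry_eq_of_rbcast h5).2]
  exact ⟨by omega, h5⟩

/-- The leader gets its own anchor back within Δ and can then leave without the timer, once it has
enough vertices. Another validator leaving an even round before its timeout must hold that anchor,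
so the leader had entered the round earlier. -/
theorem Admissible.leader_catch_up (A : X.Admissible Δ G) {H : ℕ} (hC : X.Complete H)
    {k i : Fin P.n} (hk : k ∈ X.correct) (hi : i ∈ X.correct) {q : ℕ} (hq : 1 ≤ q)
    (he : q % 2 = 0) (hl : P.leader q = k) (hΔ : 1 ≤ Δ) (hRk : X.Reaches k q)
    (hRi : X.Reaches i (q + 1)) (hH : X.entry k q ≤ H) :
    X.entry k (q + 1) ≤ max (X.entry k q) (max (X.entry i (q + 1)) X.gst) + Δ ∧
      (X.entry i q + P.timeout ≤ X.entry i (q + 1) ∨ X.entry k q < X.entry i (q + 1)) := by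
  obtain ⟨h1, h2⟩ := hRi.quick
  obtain ⟨-, v, hv, hr, hs⟩ := hRk.rbcast_entry hq
  constructor
  · refine (A.entry_succ_le hk hRk (Or.inr (by omega)) (h1.trans (Finset.card_le_card
      (Protocol.layer_mono (A.dag_transfer hi hk (by omega)) q))) (Or.inr ?_)).2
    unfold Protocol.Quick
    rw [if_pos he, (A.midState_inv hk _).dagInv.getAnchor_eq
      (A.mem_dag_of_rbcast hC hk hk hH hv (by omega)) hr (hs.trans hl.symm) he]
    rfl
  · refine h2.imp_right fun h => ?_
    unfold Protocol.Quick at h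
    rw [if_pos he] at h
    obtain ⟨a, ha⟩ := Option.isSome_iff_exists.1 h
    exact (A.anchor_of_correct hk hi hq hl ha).1

theorem Reaches.le_entry {i : Fin P.n} {q : ℕ} (h : X.Reaches i (q + 1)) :
    q ≤ X.entry i (q + 1) := by
  induction q with
  | zero => exact Nat.zero_le _
  | succ q ih =>
    have h1 := ih (h.of_le (Nat.le_succ _))
    have h2 := h.entry_lt (by omega)
    omega

variable (X) in
/-- Validator `k` enters round `q` at most `ℓ` ticks after any correct validator. -/
def Lag (k : Fin P.n) (q ℓ : ℕ) : Prop := ∀ i ∈ X.correct, X.entry k q ≤ X.entry i q + ℓ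

/-- A quick exit costs `k` one tick after its entry, and `i` also spends at least one tick in the
round; a timeout costs both the same; catching up costs Δ, which is at most `ℓ`. The condition `gst
< q` puts the exit after GST, as there is at most one round per tick. -/
theorem Lag.succ {k : Fin P.n} {q ℓ : ℕ} (h : X.Lag k q ℓ) (A : X.Admissible Δ G)
    (hk : k ∈ X.correct) (hR : ∀ i ∈ X.correct, X.Reaches i (q + 1)) (hq : X.gst < q)
    (hΔ : 1 ≤ Δ) (hT : 2 * Δ ≤ P.timeout) (hℓ : Δ ≤ ℓ) : X.Lag k (q + 1) ℓ := by
  intro i hi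
  have h1 := h i hi
  have h2 := (hR i hi).entry_lt (by omega)
  have h3 := (hR i hi).le_entry
  have h4 := A.catch_up hk hi ((hR k hk).of_le (Nat.le_succ q)) (hR i hi) (by omega)
  omega

/-- If `i` leaves quickly, the new lag is at most Δ. If it times out, it loses at least 2Δ while the
leader needs only Δ, so the lag is at most Δ or falls by at least Δ, hence by at least one. -/
theorem Lag.succ_leader {k : Fin P.n} {q ℓ H : ℕ} (h : X.Lag k q ℓ) (A : X.Admissible Δ G)
    (hC : X.Complete H) (hk : k ∈ X.correct) (hR : ∀ i ∈ X.correct, X.Reaches i (q + 1))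
    (hq : X.gst < q) (hΔ : 1 ≤ Δ) (hT : 2 * Δ ≤ P.timeout) (he : q % 2 = 0)
    (hl : P.leader q = k) (hH : X.entry k q ≤ H) : X.Lag k (q + 1) (max Δ (ℓ - 1)) := by
  intro i hi
  have h1 := h i hi
  have h2 := (hR i hi).entry_lt (by omega)
  have h3 := (hR i hi).le_entry
  have h4 := A.leader_catch_up hC hk hi (by omega) he hl hΔ ((hR k hk).of_le (Nat.le_succ q))
    (hR i hi) hH
  omega

theorem Lag.of_le {k : Fin P.n} {q q' ℓ : ℕ} (h : X.Lag k q ℓ) (A : X.Admissible Δ G)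
    (hk : k ∈ X.correct) (hqq : q ≤ q') (hR : ∀ i ∈ X.correct, X.Reaches i q') (hq : X.gst < q)
    (hΔ : 1 ≤ Δ) (hT : 2 * Δ ≤ P.timeout) (hℓ : Δ ≤ ℓ) : X.Lag k q' ℓ := by
  induction hqq with
  | refl => exact h
  | step hle ih =>
    have hle' : q ≤ _ := hle
    exact (ih fun i hi => (hR i hi).of_le (Nat.le_succ _)).succ A hk hR (by omega) hΔ hT hℓ

/-! ### Commitment of the anchors of correct leaders -/

/-- If the leader is not late, then its anchor is supported in the DAG of every correct validator. -/
theorem Lag.supported {k : Fin P.n} {q H : ℕ} (h : X.Lag k q Δ) (A : X.Admissible Δ G)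
    (hC : X.Complete H) (hk : k ∈ X.correct) (hq : X.gst < q) (hΔ : 1 ≤ Δ)
    (hT : 2 * Δ ≤ P.timeout) (he : q % 2 = 0) (hl : P.leader q = k)
    (hH : X.gst + (q + 1) * P.timeout ≤ H) {y : ℕ} (hy : X.gst + (q + 1) * P.timeout + Δ ≤ y)
    {v : Vertex 𝕋 P.n} (hv : X.rbcast k (X.entry k q) = some v) :
    P.Supported (X.midState k y).dag v := by
  have hR := A.reaches hC hΔ hT (q + 1) hH
  have hRk := (hR k hk).1.of_le (Nat.le_succ q)
  have hek := (hR k hk).1.entry_lt (by omega)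
  have hek' := (hR k hk).2
  obtain ⟨hr, hs⟩ : v.round = q ∧ v.source = k := by
    obtain ⟨-, w, hw, h1, h2⟩ := hRk.rbcast_entry (by omega)
    rw [hv, Option.some.injEq] at hw
    exact hw ▸ ⟨h1, h2⟩
  have hek2 : X.gst ≤ X.entry k q := by
    obtain ⟨q', rfl⟩ : ∃ q', q = q' + 1 := ⟨q - 1, by omega⟩
    have := hRk.le_entry
    omega
  refine ⟨A.mem_dag_of_rbcast hC hk hk (by omega) hv (by omega), by omega, by omega,
    by rw [hs, hr, hl], ?_⟩
  apply A.le_card_of_sources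
  intro i hi
  obtain ⟨hRi, hei⟩ := hR i hi
  have h1 := h i hi
  have hanchor : P.getAnchor (X.midState i (X.entry i (q + 1))).dag q = some v := by
    -- On a timeout exit the anchor has arrived, since lag plus delivery is at most 2Δ, hence at
    -- most the timeout. A quick exit from an even round requires some anchor, and that can only be
    -- the vertex created by `k`.
    rcases hRi.quick.2 with h2 | h2
    · exact (A.midState_inv hi _).dagInv.getAnchor_eq
        (A.mem_dag_of_rbcast hC hk hi (by omega) hv (by omega)) hr (hs.trans hl.symm) he
    · unfold Protocol.Quick at h2
      rw [if_pos he] at h2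
      obtain ⟨a, ha⟩ := Option.isSome_iff_exists.1 h2
      rw [ha, ← hv, (A.anchor_of_correct hk hi (by omega) hl ha).2]
  obtain ⟨h3, w, hw, hwr, hws⟩ := hRi.rbcast_entry (by omega)
  refine ⟨w, Finset.mem_filter.2 ⟨Finset.mem_filter.2
    ⟨A.mem_dag_of_rbcast hC hi hk (by omega) hw (by omega), by omega⟩, ?_⟩, hws⟩
  rw [rbcast_edges_eq hw, Nat.add_right_cancel h3, hanchor]
  simp

/-- Every created vertex links to its creator's previous one, so the vertices of a validator form a
chain. -/
theorem Reaches.reach_own {k : Fin P.n} {q s : ℕ} (h : X.Reaches k q) (hs : 1 ≤ s) (hsq : s ≤ q)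
    {v w : Vertex 𝕋 P.n} (hv : X.rbcast k (X.entry k q) = some v)
    (hw : X.rbcast k (X.entry k s) = some w) : Reach v w := by
  induction hsq generalizing v with
  | refl =>
    rw [hv, Option.some.injEq] at hw
    rw [hw]
    exact Relation.ReflTransGen.refl
  | @step q hle ih =>
    have hle' : s ≤ q := hle
    change X.Reaches k (q + 1) at h
    change X.rbcast k (X.entry k (q + 1)) = some v at hv
    obtain ⟨h1, -⟩ := h.rbcast_entry (by omega)
    have h2 : (X.state k (X.entry k (q + 1))).round = q := by omega
    have h3 := (timer_own (X := X) k (X.entry k (q + 1))).2.2 (by omega)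
    rw [h2] at h3
    refine (ih (h.of_le (Nat.le_succ q)) h3.2).head ⟨?_, ?_⟩
    · rw [rbcast_edges_eq hv]
      simp
    · have h4 := (own_round_source (X := X) k (X.entry k (q + 1))).1
      omega

theorem leader_two_mul (k : Fin P.n) (m : ℕ) : P.leader (2 * (k + P.n * m)) = k := by
  apply Fin.ext
  change 2 * (k.val + P.n * m) / 2 % P.n = k.val
  rw [Nat.mul_div_cancel_left _ (by omega), Nat.add_mul_mod_self_left, Nat.mod_eq_of_lt k.isLt]

/-- The lag of a correct validator decreases whenever it is the leader. -/
theorem Admissible.lag_leader (A : X.Admissible Δ G) {H : ℕ} (hC : X.Complete H)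
    {k : Fin P.n} (hk : k ∈ X.correct) (hΔ : 1 ≤ Δ) (hT : 2 * Δ ≤ P.timeout) {m L : ℕ}
    (hm : X.gst < 2 * (k + P.n * m)) (hL : X.gst + 2 * (k + P.n * m) * P.timeout ≤ L) (x : ℕ)
    (hx : X.gst + 2 * (k + P.n * (m + x)) * P.timeout ≤ H) :
    X.Lag k (2 * (k + P.n * (m + x))) (max Δ (L - x)) := by
  induction x with
  | zero =>
    intro i _
    -- Crude initial bound: the absolute entry tick is at most `L`, so the lag is too.
    have := (A.reaches hC hΔ hT _ hx k hk).2
    rw [Nat.add_zero] at this ⊢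
    omega
  | succ x ih =>
    have hn : 1 ≤ P.n := Nat.succ_le_succ (Nat.zero_le _)
    -- Only even rounds have anchors, so consecutive turns of a leader are 2n rounds apart. The lag
    -- falls at the first of these rounds and is kept through the others.
    have hstep : 2 * (k.val + P.n * (m + (x + 1))) = 2 * (k.val + P.n * (m + x)) + 2 * P.n := by ring
    have hmx : P.n * m ≤ P.n * (m + x) := Nat.mul_le_mul_left _ (Nat.le_add_right _ _)
    rw [hstep] at hx ⊢
    set q := 2 * (k.val + P.n * (m + x)) with hqdef
    have hmono : ∀ q' ≤ q + 2 * P.n, X.gst + q' * P.timeout ≤ H := fun q' hq' =>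
      (Nat.add_le_add_left (Nat.mul_le_mul_right _ hq') _).trans hx
    have hR := fun q' hq' => A.reaches hC hΔ hT q' (hmono q' hq')
    have h1 := (ih (hmono q (by omega))).succ_leader A hC hk
      (fun i hi => (hR (q + 1) (by omega) i hi).1) (by omega) hΔ hT (by omega)
      (leader_two_mul k (m + x)) ((hR q (by omega) k hk).2.trans (hmono q (by omega)))
    have h2 := h1.of_le A hk (by omega : q + 1 ≤ q + 2 * P.n)
      (fun i hi => (hR _ le_rfl i hi).1) (by omega) hΔ hT (le_max_left _ _)
    intro i hi
    have := h2 i hi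
    omega

theorem Admissible.validity_of_sound (A : X.Admissible Δ G) {H τ m L : ℕ} (hC : X.Complete H)
    (hS : X.Sound H) (hΔ : 1 ≤ Δ) (hT : 2 * Δ ≤ P.timeout) (hm : X.gst < m)
    (hL : X.gst + 2 * (P.n * (m + 1)) * P.timeout ≤ L)
    (hH : X.gst + (2 * (P.n * (m + L + τ + 1)) + 2) * P.timeout ≤ H) : X.Validity τ := by
  intro k hk b s hs hb
  have hkn : k.val < P.n := k.isLt
  have hn : 1 ≤ P.n := Nat.succ_le_succ (Nat.zero_le _)
  have hs1 := hb.1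
  have e1 : P.n * (m + 1) = P.n * m + P.n := by ring
  have e2 : P.n * (m + L + τ + 1) = P.n * (m + (L + τ)) + P.n := by ring
  have e3 : m + (L + τ) ≤ P.n * (m + (L + τ)) := Nat.le_mul_of_pos_left _ hn
  have e4 : m ≤ P.n * m := Nat.le_mul_of_pos_left _ hn
  -- The turn of `k` numbered `m + L + τ`: `m` puts the start after GST, `L` further turns bring the
  -- lag from `L` down to Δ, and `τ` more make `q ≥ s`.
  set q := 2 * (k.val + P.n * (m + (L + τ))) with hq
  have hq2 : q + 2 ≤ 2 * (P.n * (m + L + τ + 1)) + 2 := by omega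
  have hmono : ∀ q' ≤ q + 2, X.gst + q' * P.timeout ≤ H := fun q' hq' =>
    (Nat.add_le_add_left (Nat.mul_le_mul_right _ (hq'.trans hq2)) _).trans hH
  have hlag : X.Lag k q Δ := by
    have h1 := A.lag_leader hC hk hΔ hT (m := m) (L := L) (by omega)
      ((Nat.add_le_add_left (Nat.mul_le_mul_right _ (by omega)) _).trans hL) (L + τ)
      (hmono q (by omega))
    intro i hi
    have := h1 i hi
    rw [← hq] at this
    omega
  obtain ⟨hRk, -⟩ := A.reaches hC hΔ hT q (hmono q (by omega)) k hk
  obtain ⟨-, v, hv, hvr, -⟩ := hRk.rbcast_entry (by omega)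
  obtain ⟨-, w, hw, hwr, hws⟩ := (hRk.of_le (by omega : s ≤ q)).rbcast_entry hs1
  have hy : X.gst + (q + 1) * P.timeout + Δ ≤ H := by
    have h1 := hmono (q + 2) le_rfl
    have h2 : (q + 2) * P.timeout = (q + 1) * P.timeout + P.timeout := by ring
    omega
  have hsup := hlag.supported A hC hk (by omega) hΔ hT (by omega) (leader_two_mul k _)
    (hmono (q + 1) (by omega)) le_rfl hv
  have hord := A.ordered_of_supported hS hk hy hsup (hRk.reach_own hs1 (by omega) hv hw)
  obtain ⟨b', hb1, hb2⟩ := rbcast_block hw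
  rw [hwr] at hb2
  refine ⟨X.gst + (q + 1) * P.timeout + Δ + 1, w, ?_, ?_, hwr, hws⟩
  · rwa [(state_succ_frame k _).2.2.1]
  · rw [hb1, hb.eq hb2]

end Execution
end SparseBullshark

namespace SparseBullshark
open scoped Classical

/-! ### Bad seeds -/

namespace Protocol
variable {𝕋 : Alphabet} (P : Protocol 𝕋)

/-- The entries of round `r` that do not reference `v`, or have too many edges. -/
noncomputable def nonSupporters (a : Fin P.n → Option (Ref 𝕋 P.n)) (r : ℕ) (v : Vertex 𝕋 P.n) :
    Finset (Ref 𝕋 P.n) :=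
  (P.entries a).filter fun y =>
    y.1.round = r ∧ ¬ (y.1.edges.toFinset.card ≤ P.D + 2 ∧ v ∈ y.1.edges)

/-- The sets of entries of an array from which no accepted sample should be drawn when they are
small: for some round, all its entries or those that do not reference some given vertex. -/
noncomputable def candidates (a : Fin P.n → Option (Ref 𝕋 P.n)) : Finset (Finset (Ref 𝕋 P.n)) :=
  (P.entries a).biUnion fun x =>
    insert ((P.entries a).filter fun y => y.1.round = x.1.round)
      (if x.1.edges.toFinset.card ≤ P.D + 2 then
        x.1.edges.toFinset.image (P.nonSupporters a x.1.round) else ∅)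

/-- The seeds for which ALBA fails on the array `a`. -/
def badSeeds (a : Fin P.n → Option (Ref 𝕋 P.n)) : Set P.Seed :=
  {s | 2 * P.f + 1 ≤ (P.entries a).card ∧ P.alba.verify s (P.alba.prove s (P.entries a)) = false} ∪
    ⋃ F ∈ P.candidates a, {s | F.card ≤ P.f ∧
      ∃ l : List (Ref 𝕋 P.n), (∀ x ∈ l, x ∈ F) ∧ P.alba.verify s l = true}

variable {P}

theorem card_entries_le (a : Fin P.n → Option (Ref 𝕋 P.n)) : (P.entries a).card ≤ P.n := by
  have := Finset.card_biUnion_le_card_mul (Finset.univ : Finset (Fin P.n))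
    (fun i => (a i).toFinset) 1 (fun i _ => by cases a i <;> simp)
  simpa [entries] using this

/-- The edge bound of validation is what keeps this number polynomial: references by oversized
entries are not counted. -/
theorem card_candidates_le (a : Fin P.n → Option (Ref 𝕋 P.n)) :
    (P.candidates a).card ≤ P.n * (P.D + 3) := by
  refine (Finset.card_biUnion_le_card_mul _ _ (P.D + 3) fun x _ => ?_).trans
    (Nat.mul_le_mul_right _ (card_entries_le a))
  refine (Finset.card_insert_le _ _).trans (Nat.succ_le_succ ?_)
  split
  · next h => exact Finset.card_image_le.trans h
  · simp

/-- If some entry of the round with few edges references `v`, the set is listed under that entry.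
Otherwise it consists of all entries of the round, listed under `x`. So no prior knowledge of `v` is
needed. -/
theorem mem_candidates_of_nonSupporters {a : Fin P.n → Option (Ref 𝕋 P.n)} {x : Ref 𝕋 P.n}
    (hx : x ∈ P.entries a) (v : Vertex 𝕋 P.n) :
    P.nonSupporters a x.1.round v ∈ P.candidates a := by
  by_cases h : ∃ y ∈ P.entries a, y.1.round = x.1.round ∧
      y.1.edges.toFinset.card ≤ P.D + 2 ∧ v ∈ y.1.edges
  · obtain ⟨y, h1, h2, h3, h4⟩ := h
    refine Finset.mem_biUnion.2 ⟨y, h1, Finset.mem_insert_of_mem ?_⟩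
    rw [if_pos h3, ← h2]
    exact Finset.mem_image_of_mem _ (List.mem_toFinset.2 h4)
  · refine Finset.mem_biUnion.2 ⟨x, hx, ?_⟩
    have : P.nonSupporters a x.1.round v =
        (P.entries a).filter fun y => y.1.round = x.1.round := by
      refine Finset.filter_congr fun y hy => ⟨And.left, fun hr => ⟨hr, fun hc => h ⟨y, hy, hr, hc⟩⟩⟩
    rw [this]
    exact Finset.mem_insert_self _ _

theorem seedLaw_badSeeds_le (a : Fin P.n → Option (Ref 𝕋 P.n)) :
    P.seedLaw (P.badSeeds a) ≤ ((1 + P.n * (P.D + 3) : ℕ) : ℝ≥0∞) * P.albaError := by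
  have h1 : P.seedLaw {s | 2 * P.f + 1 ≤ (P.entries a).card ∧
      P.alba.verify s (P.alba.prove s (P.entries a)) = false} ≤ P.albaError := by
    by_cases h : 2 * P.f + 1 ≤ (P.entries a).card
    · exact (measure_mono fun s hs => hs.2).trans (P.alba.completeness _ h)
    · simp [h]
  have h2 : ∀ F : Finset (Ref 𝕋 P.n), P.seedLaw {s | F.card ≤ P.f ∧
      ∃ l : List (Ref 𝕋 P.n), (∀ x ∈ l, x ∈ F) ∧ P.alba.verify s l = true} ≤ P.albaError := by
    intro F
    by_cases h : F.card ≤ P.f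
    · exact (measure_mono fun s hs => hs.2).trans (P.alba.soundness _ h)
    · simp [h]
  calc P.seedLaw (P.badSeeds a)
      ≤ P.albaError + ∑ _F ∈ P.candidates a, P.albaError :=
        (measure_union_le _ _).trans (add_le_add h1 ((measure_biUnion_finset_le _ _).trans
          (Finset.sum_le_sum fun F _ => h2 F)))
    _ = ((1 + (P.candidates a).card : ℕ) : ℝ≥0∞) * P.albaError := by
        rw [Finset.sum_const, nsmul_eq_mul]
        push_cast
        ring
    _ ≤ _ := by
        gcongr
        exact card_candidates_le a

end Protocol

namespace Execution
variable {𝕋 : Alphabet} {P : Protocol 𝕋} {X : Execution P} {Δ G : ℕ}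

/-- At most `f` certified entries of the next round do not support a supported anchor. -/
theorem Admissible.card_nonSupporters_le (A : X.Admissible Δ G) {j : Fin P.n}
    (hj : j ∈ X.correct) {t : ℕ} {a : Vertex 𝕋 P.n} (ha : P.Supported (X.midState j t).dag a)
    {vec : Fin P.n → Option (Ref 𝕋 P.n)}
    (hvec : ∀ i v σ, vec i = some (v, σ) → X.certified v.round i = some v) :
    (P.nonSupporters vec (a.round + 1) a).card ≤ P.f := by
  have I := (A.midState_inv hj t).dagInv
  set S := (P.layer (X.midState j t).dag (a.round + 1)).filter (fun u => a ∈ u.edges) with hS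
  have hmem : ∀ u ∈ S, u ∈ (X.midState j t).dag ∧ u.round = a.round + 1 ∧ a ∈ u.edges := by
    intro u hu
    obtain ⟨h1, h2⟩ := Finset.mem_filter.1 hu
    obtain ⟨h3, h4⟩ := Finset.mem_filter.1 h1
    exact ⟨h3, h4, h2⟩
  have hcard : 2 * P.f + 1 ≤ (S.image Vertex.source).card := by
    rw [Finset.card_image_of_injOn]
    · exact ha.2.2.2.2
    · intro u hu v hv huv
      have h1 := hmem u hu
      have h2 := hmem v hv
      exact I.unique h1.1 h2.1 (h1.2.1.trans h2.2.1.symm) huv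
  -- At most one vertex is certified per round and source, so an entry of this round at the source
  -- of a supporter is the supporter. The rest comes from `n - (2f+1) = f` sources.
  have hsub : P.nonSupporters vec (a.round + 1) a ⊆
      ((S.image Vertex.source)ᶜ).biUnion fun i => (vec i).toFinset := by
    rintro ⟨x, σ⟩ hx
    obtain ⟨h1, h2, h3⟩ := Finset.mem_filter.1 hx
    obtain ⟨i, hi⟩ := Protocol.mem_entries.1 h1
    refine Finset.mem_biUnion.2 ⟨i, Finset.mem_compl.2 fun hmi => h3 ?_, by simp [hi]⟩
    obtain ⟨u, hu, rfl⟩ := Finset.mem_image.1 hmi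
    obtain ⟨h4, h5, h6⟩ := hmem u hu
    have h7 := hvec _ _ _ hi
    dsimp only at h2
    rw [h2, ← h5, I.certified u h4, Option.some.injEq] at h7
    subst h7
    exact ⟨(I.acceptable u h4 (by omega)).card_edges, h6⟩
  have h1 := (Finset.card_le_card hsub).trans (Finset.card_biUnion_le_card_mul _ _ 1
    fun i _ => by cases vec i <;> simp)
  rw [Finset.card_compl, Fintype.card_fin] at h1
  have : P.n = 3 * P.f + 1 := rfl
  omega

end Execution

/-! ### From the hash log to sound and complete sampling -/

namespace HashLog
variable {𝕋 : Alphabet} {P : Protocol 𝕋} {Ω : Type} [mΩ : MeasurableSpace Ω]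
  {μ : Measure Ω} {X : Ω → Execution P} (L : HashLog μ X) {Δ G : ℕ}

/-- One of the first `K` evaluations returns a bad seed for the array attached to it. -/
def hashBad (K : ℕ) : Set Ω :=
  {ω | ∃ k < K, ∃ c, L.FirstAt ω k c ∧ (X ω).hash c ∈ P.badSeeds (L.vec k ω)}

variable {L}

theorem exists_firstAt {ω : Ω} {k : ℕ} {c : 𝕋.Comm} (h : L.comm k ω = c) :
    ∃ k' ≤ k, L.FirstAt ω k' c := by
  have hex : ∃ k, L.comm k ω = c := ⟨k, h⟩
  exact ⟨Nat.find hex, Nat.find_min' hex h, Nat.find_spec hex, fun j hj => Nat.find_min hex hj⟩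

/-- Someone else may have hashed the commitment first; binding says that the array attached then is
the one committed to, so ALBA completeness for that array applies. -/
theorem complete_of_not_bad {ω : Ω} {H K : ℕ} (A : (X ω).Admissible Δ G)
    (hcreate : ∀ i ∈ (X ω).correct, ∀ t, ((X ω).rbcast i t).isSome = true →
      ∃ k < L.budget t, L.comm k ω = P.vc.commit ((X ω).array i t))
    (hK : ∀ t ≤ H, L.budget t ≤ K) (hb : ω ∉ L.bindingBroken H) (hh : ω ∉ L.hashBad K) :
    (X ω).Complete H := by
  intro i hi t ht v hv
  have hsome : ((X ω).rbcast i t).isSome = true := by rw [hv]; rfl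
  obtain ⟨k, hk, hc⟩ := hcreate i hi t hsome
  obtain ⟨k', hk', hfirst⟩ := exists_firstAt hc
  have hvec : L.vec k' ω = (X ω).array i t := by
    by_contra hne
    exact hb ⟨i, hi, t, ht, Or.inl ⟨hsome, k', hfirst, hne⟩⟩
  refine A.acceptable_of_rbcast hi hv ?_
  by_contra hne
  refine hh ⟨k', (hk'.trans_lt hk).trans_le (hK t ht), _, hfirst, Or.inl ?_⟩
  rw [hvec]
  exact ⟨A.two_mul_f_lt_card_entries hi hv, by simpa using hne⟩

/-- A vertex that samples no supporter would exhibit an accepted sample inside a set of at most f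
entries of the array fixed before its seed. -/
theorem sound_of_not_bad {ω : Ω} {H K : ℕ} (A : (X ω).Admissible Δ G)
    (hcert : ∀ k i v σ, L.vec k ω i = some (v, σ) →
      (X ω).certified v.round i = some v ∧ (X ω).cert v = σ)
    (hvalidate : ∀ i ∈ (X ω).correct, ∀ t, ∀ e ∈ (X ω).inbox i t, ∀ c ∈ e.1.comm,
      ∃ k < L.budget t, L.comm k ω = c)
    (hK : ∀ t ≤ H, L.budget t ≤ K) (hb : ω ∉ L.bindingBroken H) (hh : ω ∉ L.hashBad K) :
    (X ω).Sound H := by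
  intro j hj t ht a ha w hw hr
  have I := (A.midState_inv hj t).dagInv
  obtain ⟨hacc, t', ht', hin⟩ := (A.midState_inv hj t).of_dag w hw (by omega)
  obtain ⟨c, hc, hver⟩ := hacc.verify
  obtain ⟨k, hk, hkc⟩ := hvalidate j hj t' _ hin c hc
  obtain ⟨k', hk', hfirst⟩ := exists_firstAt hkc
  have hvec : ∀ u ∈ w.sample, L.vec k' ω u.source = some (u, (X ω).cert u) := by
    intro u hu
    by_contra hne
    exact hb ⟨j, hj, t, ht, Or.inr ⟨w, hw, c, hc, k', hfirst, u, hu, hne⟩⟩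
  have hround : ∀ u ∈ w.sample, u.round = a.round + 1 := by
    intro u hu
    have := I.edges_round hw (w.sample_subset_edges u hu)
    omega
  by_contra hne
  push Not at hne
  -- Any sampled vertex witnesses that the array has an entry in the round above the anchor.
  obtain ⟨u₀, hu₀⟩ := hacc.exists_sample
  have hcand := Protocol.mem_candidates_of_nonSupporters
    (Protocol.mem_entries.2 ⟨_, hvec u₀ hu₀⟩) a
  dsimp only at hcand
  rw [hround u₀ hu₀] at hcand
  refine hh ⟨k', (hk'.trans_lt hk).trans_le (hK t' (by omega)), c, hfirst, Or.inr ?_⟩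
  refine Set.mem_biUnion hcand ⟨A.card_nonSupporters_le hj ha fun i v σ h => (hcert k' i v σ h).1,
    _, ?_, hver⟩
  intro x hx
  obtain ⟨u, hu, rfl⟩ := List.mem_map.1 hx
  exact Finset.mem_filter.2 ⟨Protocol.mem_entries.2 ⟨_, hvec u hu⟩, hround u hu,
    fun h => hne u hu h.2⟩

end HashLog
end SparseBullshark

namespace SparseBullshark
open scoped Classical

/-! ### Countability -/

theorem countable_lists {α : Type*} {S : Set α} (h : S.Countable) :
    {l : List α | ∀ x ∈ l, x ∈ S}.Countable := by
  have := h.to_subtype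
  refine (Set.countable_range (fun l : List S => l.map Subtype.val)).mono fun l hl => ?_
  exact ⟨l.pmap Subtype.mk hl, by dsimp only; rw [List.map_pmap]; simp⟩

namespace Vertex
variable {𝕋 : Alphabet} {n : ℕ}

variable (𝕋 n) in
/-- Vertices of nesting depth at most `d`. -/
def ofDepth : ℕ → Set (Vertex 𝕋 n)
  | 0 => Set.range genesis
  | d + 1 => ofDepth d ∪
      ⋃ (l₁ ∈ {l : List (Vertex 𝕋 n) | ∀ x ∈ l, x ∈ ofDepth d})
        (l₂ ∈ {l : List (Vertex 𝕋 n) | ∀ x ∈ l, x ∈ ofDepth d}),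
        Set.range fun p : ℕ × Fin n × 𝕋.Block × 𝕋.Comm × List 𝕋.Opening =>
          node p.1 p.2.1 p.2.2.1 l₁ l₂ p.2.2.2.1 p.2.2.2.2

theorem ofDepth_mono : Monotone (ofDepth 𝕋 n) :=
  monotone_nat_of_le_succ fun _ => Set.subset_union_left

theorem countable_ofDepth (d : ℕ) : (ofDepth 𝕋 n d).Countable := by
  have := 𝕋.countable_block
  have := 𝕋.countable_comm
  have := 𝕋.countable_opening
  induction d with
  | zero => exact Set.countable_range _
  | succ d ih =>
    exact ih.union ((countable_lists ih).biUnion fun _ _ =>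
      (countable_lists ih).biUnion fun _ _ => Set.countable_range _)

theorem exists_mem_ofDepth (v : Vertex 𝕋 n) : ∃ d, v ∈ ofDepth 𝕋 n d := by
  -- The type is nested through lists, so the recursor needs a second motive, a common depth for a
  -- list.
  refine Vertex.rec (motive_1 := fun v => ∃ d, v ∈ ofDepth 𝕋 n d)
    (motive_2 := fun l => ∃ d, ∀ x ∈ l, x ∈ ofDepth 𝕋 n d) ?_ ?_ ?_ ?_ v
  · exact fun i => ⟨0, i, rfl⟩
  · rintro r i b l₁ l₂ c o ⟨d₁, h₁⟩ ⟨d₂, h₂⟩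
    refine ⟨max d₁ d₂ + 1, Or.inr ?_⟩
    refine Set.mem_biUnion (x := l₁) (fun x hx => ofDepth_mono (le_max_left _ _) (h₁ x hx)) ?_
    exact Set.mem_biUnion (x := l₂) (fun x hx => ofDepth_mono (le_max_right _ _) (h₂ x hx))
      ⟨(r, i, b, c, o), rfl⟩
  · exact ⟨0, by simp⟩
  · rintro x l ⟨d₁, h₁⟩ ⟨d₂, h₂⟩
    refine ⟨max d₁ d₂, fun y hy => ?_⟩
    rcases List.mem_cons.1 hy with rfl | hy
    · exact ofDepth_mono (le_max_left _ _) h₁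
    · exact ofDepth_mono (le_max_right _ _) (h₂ y hy)

-- Needed to sum over all possible arrays in `measure_bad_le`.
instance : Countable (Vertex 𝕋 n) := by
  rw [← Set.countable_univ_iff]
  exact (Set.countable_iUnion countable_ofDepth).mono fun v _ =>
    Set.mem_iUnion.2 (exists_mem_ofDepth v)

end Vertex

/-! ### The union bound over the evaluations of the hash function -/

namespace HashLog
variable {𝕋 : Alphabet} {P : Protocol 𝕋} {Ω : Type} [mΩ : MeasurableSpace Ω]
  {μ : Measure Ω} {X : Ω → Execution P} (L : HashLog μ X)

theorem measurableSet_firstAt (k : ℕ) (c : 𝕋.Comm) :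
    MeasurableSet[L.ℱ k] {ω | L.FirstAt ω k c} := by
  have : {ω | L.FirstAt ω k c} = {ω | L.comm k ω = c} ∩ ⋂ j ∈ Finset.range k,
      {ω | L.comm j ω = c}ᶜ := by
    ext ω
    simp [FirstAt]
  rw [this]
  refine MeasurableSet.inter (L.adapted_comm k c) (Finset.measurableSet_biInter _ fun j hj => ?_)
  exact (L.ℱ.mono (Finset.mem_range.1 hj).le _ (L.adapted_comm j c)).compl

/-- Condition on the commitment and the attached array: these are countably many disjoint events
known before the answer, and on each of them the seed is fresh. -/
theorem measure_bad_le [IsProbabilityMeasure μ] {b : ℝ≥0∞}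
    (hb : ∀ a, P.seedLaw (P.badSeeds a) ≤ b) (k : ℕ) :
    μ {ω | ∃ c, L.FirstAt ω k c ∧ (X ω).hash c ∈ P.badSeeds (L.vec k ω)} ≤ b := by
  have := 𝕋.countable_comm
  have := 𝕋.countable_cert
  let A : 𝕋.Comm × (Fin P.n → Option (Ref 𝕋 P.n)) → Set Ω := fun p =>
    {ω | L.FirstAt ω k p.1} ∩ {ω | L.vec k ω = p.2}
  have hA : ∀ p, MeasurableSet[L.ℱ k] (A p) := fun p =>
    (L.measurableSet_firstAt k p.1).inter (L.adapted_vec k p.2)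
  have hdisj : Pairwise fun p q => Disjoint (A p) (A q) := by
    intro p q hpq
    refine Set.disjoint_left.2 fun ω h1 h2 => hpq ?_
    exact Prod.ext (h1.1.1.symm.trans h2.1.1) (h1.2.symm.trans h2.2)
  -- Bad seeds are not assumed measurable, while freshness is stated for measurable sets; the
  -- measurable hull has the same measure.
  have hsub : {ω | ∃ c, L.FirstAt ω k c ∧ (X ω).hash c ∈ P.badSeeds (L.vec k ω)} ⊆
      ⋃ p, A p ∩ {ω | (X ω).hash p.1 ∈ toMeasurable P.seedLaw (P.badSeeds p.2)} := by
    rintro ω ⟨c, h1, h2⟩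
    exact Set.mem_iUnion.2 ⟨(c, L.vec k ω), ⟨h1, rfl⟩, subset_toMeasurable _ _ h2⟩
  calc _ ≤ ∑' p, μ (A p ∩ {ω | (X ω).hash p.1 ∈ toMeasurable P.seedLaw (P.badSeeds p.2)}) :=
        (measure_mono hsub).trans (measure_iUnion_le _)
    _ ≤ ∑' p, μ (A p) * b := by
        refine ENNReal.tsum_le_tsum fun p => ?_
        rw [L.fresh k p.1 (A p) _ (hA p) (measurableSet_toMeasurable _ _) fun ω hω => hω.1,
          measure_toMeasurable]
        gcongr
        exact hb p.2
    _ = (∑' p, μ (A p)) * b := ENNReal.tsum_mul_right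
    _ ≤ 1 * b := by
        gcongr
        rw [← measure_univ (μ := μ)]
        exact tsum_measure_le_measure_univ (fun p => (L.ℱ.le k _ (hA p)).nullMeasurableSet)
          fun p q hpq => (hdisj hpq).aedisjoint
    _ = b := one_mul b

theorem measure_hashBad_le [IsProbabilityMeasure μ] (K : ℕ) :
    μ (L.hashBad K) ≤ ((K * (1 + P.n * (P.D + 3)) : ℕ) : ℝ≥0∞) * P.albaError := by
  have hsub : L.hashBad K ⊆ ⋃ k ∈ Finset.range K,
      {ω | ∃ c, L.FirstAt ω k c ∧ (X ω).hash c ∈ P.badSeeds (L.vec k ω)} := by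
    rintro ω ⟨k, hk, h⟩
    exact Set.mem_biUnion (Finset.mem_coe.2 (Finset.mem_range.2 hk)) h
  refine (measure_mono hsub).trans ((measure_biUnion_finset_le _ _).trans
    ((Finset.sum_le_sum fun k _ => L.measure_bad_le Protocol.seedLaw_badSeeds_le k).trans ?_))
  rw [Finset.sum_const, Finset.card_range, nsmul_eq_mul, Nat.cast_mul, mul_assoc]

end HashLog

/-! ### Asymptotics -/

theorem eval_nat_mono (p : Polynomial ℕ) : Monotone fun x => p.eval x := by
  intro x y hxy
  dsimp only
  rw [Polynomial.eval_eq_sum_range, Polynomial.eval_eq_sum_range]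
  exact Finset.sum_le_sum fun i _ => Nat.mul_le_mul_left _ (Nat.pow_le_pow_left hxy i)

namespace PolyBounded
variable {g h : ℕ → ℕ}

theorem const (c : ℕ) : PolyBounded fun _ => c := ⟨Polynomial.C c, fun _ => by simp⟩

theorem add (hg : PolyBounded g) (hh : PolyBounded h) : PolyBounded fun x => g x + h x := by
  obtain ⟨p, hp⟩ := hg
  obtain ⟨q, hq⟩ := hh
  exact ⟨p + q, fun x => by rw [Polynomial.eval_add]; exact Nat.add_le_add (hp x) (hq x)⟩

theorem mul (hg : PolyBounded g) (hh : PolyBounded h) : PolyBounded fun x => g x * h x := by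
  obtain ⟨p, hp⟩ := hg
  obtain ⟨q, hq⟩ := hh
  exact ⟨p * q, fun x => by rw [Polynomial.eval_mul]; exact Nat.mul_le_mul (hp x) (hq x)⟩

theorem eval_add (hg : PolyBounded g) (p : Polynomial ℕ) :
    PolyBounded fun x => p.eval (x + g x) := by
  obtain ⟨q, hq⟩ := hg
  refine ⟨p.comp (Polynomial.X + q), fun x => ?_⟩
  rw [Polynomial.eval_comp, Polynomial.eval_add, Polynomial.eval_X]
  exact eval_nat_mono p (Nat.add_le_add_left (hq x) x)

/-- Monomial by monomial, from `y ^ n / n! ≤ exp y` with `y = c * x`. -/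
theorem le_exp (hg : PolyBounded g) {c : ℝ} (hc : 0 < c) :
    ∃ C : ℝ, 0 ≤ C ∧ ∀ x : ℕ, (g x : ℝ) ≤ C * Real.exp (c * x) := by
  obtain ⟨p, hp⟩ := hg
  suffices h : ∃ C : ℝ, 0 ≤ C ∧ ∀ x : ℕ, ((p.eval x : ℕ) : ℝ) ≤ C * Real.exp (c * x) by
    obtain ⟨C, h0, hC⟩ := h
    exact ⟨C, h0, fun x => (Nat.cast_le.2 (hp x)).trans (hC x)⟩
  clear hp
  induction p using Polynomial.induction_on' with
  | add p q hp hq =>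
    obtain ⟨C₁, h₁, hC₁⟩ := hp
    obtain ⟨C₂, h₂, hC₂⟩ := hq
    refine ⟨C₁ + C₂, add_nonneg h₁ h₂, fun x => ?_⟩
    rw [Polynomial.eval_add, Nat.cast_add, add_mul]
    exact add_le_add (hC₁ x) (hC₂ x)
  | monomial n a =>
    refine ⟨a * (n.factorial / c ^ n), by positivity, fun x => ?_⟩
    rw [Polynomial.eval_monomial, Nat.cast_mul, Nat.cast_pow, mul_assoc]
    gcongr
    have h := Real.pow_div_factorial_le_exp (c * x) (by positivity) n
    rw [div_le_iff₀ (by positivity), mul_pow] at h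
    rw [div_mul_eq_mul_div, le_div_iff₀ (by positivity)]
    linarith

end PolyBounded

namespace ExpSmall
variable {δ δ' : ℕ → ℝ≥0∞}

theorem mono (h : ExpSmall δ') (hle : ∀ x, δ x ≤ δ' x) : ExpSmall δ := by
  obtain ⟨C, c, hc, hC⟩ := h
  exact ⟨C, c, hc, fun x => (hle x).trans (hC x)⟩

theorem exists_nonneg (h : ExpSmall δ) : ∃ C c : ℝ, 0 ≤ C ∧ 0 < c ∧
    ∀ x : ℕ, δ x ≤ ENNReal.ofReal (C * Real.exp (-c * x)) := by
  obtain ⟨C, c, hc, hC⟩ := h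
  refine ⟨|C|, c, abs_nonneg C, hc, fun x => (hC x).trans (ENNReal.ofReal_le_ofReal ?_)⟩
  gcongr
  exact le_abs_self C

theorem add (h : ExpSmall δ) (h' : ExpSmall δ') : ExpSmall fun x => δ x + δ' x := by
  obtain ⟨C, c, hC0, hc, hC⟩ := h.exists_nonneg
  obtain ⟨C', c', hC0', hc', hC'⟩ := h'.exists_nonneg
  refine ⟨C + C', min c c', lt_min hc hc', fun x => ?_⟩
  refine (add_le_add (hC x) (hC' x)).trans ?_
  rw [← ENNReal.ofReal_add (by positivity) (by positivity), add_mul]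
  apply ENNReal.ofReal_le_ofReal
  gcongr
  · exact min_le_left _ _
  · exact min_le_right _ _

/-- Half of the decay rate absorbs the polynomial and the other half remains. -/
theorem polyBounded_mul {g : ℕ → ℕ} (h : ExpSmall δ) (hg : PolyBounded g) :
    ExpSmall fun x => (g x : ℝ≥0∞) * δ x := by
  obtain ⟨C, c, hC0, hc, hC⟩ := h.exists_nonneg
  obtain ⟨C', hC0', hC'⟩ := hg.le_exp (half_pos hc)
  refine ⟨C' * C, c / 2, half_pos hc, fun x => ?_⟩
  have h1 : (g x : ℝ≥0∞) ≤ ENNReal.ofReal (C' * Real.exp (c / 2 * x)) := by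
    rw [← ENNReal.ofReal_natCast]
    exact ENNReal.ofReal_le_ofReal (hC' x)
  refine (mul_le_mul' h1 (hC x)).trans ?_
  rw [← ENNReal.ofReal_mul (by positivity)]
  refine ENNReal.ofReal_le_ofReal (le_of_eq ?_)
  have h2 : Real.exp (-(c / 2) * x) = Real.exp (c / 2 * x) * Real.exp (-c * x) := by
    rw [← Real.exp_add]
    congr 1
    ring
  rw [h2]
  ring

end ExpSmall

/-! ### The failure probability for one security parameter -/

variable {𝕋 : Alphabet} {P : Protocol 𝕋} {Ω : Type} [mΩ : MeasurableSpace Ω]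
  {μ : Measure Ω} {X : Ω → Execution P}

/-- A property that holds in all admissible executions with sound and complete sampling fails only
if binding or ALBA fails. -/
theorem HashLog.measure_not_le [IsProbabilityMeasure μ] (L : HashLog μ X) {Δ G H K : ℕ}
    (hX : ∀ᵐ ω ∂μ, (X ω).Admissible Δ G) (hK : ∀ t ≤ H, L.budget t ≤ K)
    {Q : Execution P → Prop}
    (hQ : ∀ ω, (X ω).Admissible Δ G → (X ω).Complete H → (X ω).Sound H → Q (X ω)) :
    μ {ω | ¬ Q (X ω)} ≤ μ (L.bindingBroken H) +
      ((K * (1 + P.n * (P.D + 3)) : ℕ) : ℝ≥0∞) * P.albaError := by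
  refine le_trans (measure_mono_ae ?_) ((measure_union_le (L.bindingBroken H) (L.hashBad K)).trans
    (add_le_add le_rfl (L.measure_hashBad_le K)))
  filter_upwards [hX, L.vec_certified, L.logged_create, L.logged_validate] with ω A h1 h2 h3
  intro hω
  by_contra hne
  have hb : ω ∉ L.bindingBroken H := fun h => hne (Or.inl h)
  have hh : ω ∉ L.hashBad K := fun h => hne (Or.inr h)
  exact hω (hQ ω A (L.complete_of_not_bad A h2 hK hb hh) (L.sound_of_not_bad A h1 h3 hK hb hh))

end SparseBullshark

/-! ### Choice of the horizon and conclusion -/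

open SparseBullshark in
theorem mainTheorem2 (𝕋 : SparseBullshark.Alphabet)
    (P : ℕ → SparseBullshark.Protocol 𝕋)
    (hf : SparseBullshark.PolyBounded fun sec => (P sec).f)
    (hD : SparseBullshark.PolyBounded fun sec => (P sec).D)
    (hT : SparseBullshark.PolyBounded fun sec => (P sec).timeout)
    (hε : SparseBullshark.ExpSmall fun sec => (P sec).albaError)
    (Δ G : ℕ → ℕ) (hΔ : ∀ sec, 1 ≤ Δ sec)
    (hTΔ : ∀ sec, 2 * Δ sec ≤ (P sec).timeout)
    (hG : SparseBullshark.PolyBounded G)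
    (Ω : ℕ → Type) [∀ sec, MeasurableSpace (Ω sec)]
    (μ : ∀ sec, MeasureTheory.Measure (Ω sec))
    [∀ sec, MeasureTheory.IsProbabilityMeasure (μ sec)]
    (X : ∀ sec, Ω sec → SparseBullshark.Execution (P sec))
    (hX : ∀ sec, ∀ᵐ ω ∂(μ sec), (X sec ω).Admissible (Δ sec) (G sec))
    (L : ∀ sec, SparseBullshark.HashLog (μ sec) (X sec))
    (hL : ∃ p : Polynomial ℕ, ∀ sec t, (L sec).budget t ≤ p.eval (sec + t))
    (hbind : ∀ τ : ℕ → ℕ, SparseBullshark.PolyBounded τ →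
      SparseBullshark.ExpSmall fun sec => μ sec ((L sec).bindingBroken (τ sec)))
    (τ : ℕ → ℕ) (hτ : SparseBullshark.PolyBounded τ) :
    SparseBullshark.ExpSmall (fun sec => μ sec {ω | ¬ (X sec ω).Agreement (τ sec)}) ∧
    SparseBullshark.ExpSmall (fun sec => μ sec {ω | ¬ (X sec ω).Validity (τ sec)}) := by
  obtain ⟨p, hp⟩ := hL
  have hn : PolyBounded fun sec => (P sec).n := ((PolyBounded.const 3).mul hf).add (.const 1)
  -- The initial lag bound of `validity_of_sound` for `m = G + 1`, with GST replaced by its upper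
  -- bound. `H` below is the matching horizon, with `τ + G` added so that it also covers Agreement.
  let lag : ℕ → ℕ := fun sec => G sec + 2 * ((P sec).n * (G sec + 1 + 1)) * (P sec).timeout
  have hlag : PolyBounded lag :=
    hG.add (((PolyBounded.const 2).mul (hn.mul ((hG.add (.const 1)).add (.const 1)))).mul hT)
  let H : ℕ → ℕ := fun sec => τ sec + G sec +
    (2 * ((P sec).n * (G sec + 1 + lag sec + τ sec + 1)) + 2) * (P sec).timeout
  have hH : PolyBounded H := (hτ.add hG).add ((((PolyBounded.const 2).mul (hn.mul
    ((((hG.add (.const 1)).add hlag).add hτ).add (.const 1)))).add (.const 2)).mul hT)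
  have hbound : ExpSmall fun sec => μ sec ((L sec).bindingBroken (H sec)) +
      ((p.eval (sec + H sec) * (1 + (P sec).n * ((P sec).D + 3)) : ℕ) : ℝ≥0∞) *
        (P sec).albaError :=
    (hbind H hH).add (hε.polyBounded_mul ((hH.eval_add p).mul
      ((PolyBounded.const 1).add (hn.mul (hD.add (.const 3))))))
  have hK : ∀ sec, ∀ t ≤ H sec, (L sec).budget t ≤ p.eval (sec + H sec) := fun sec t ht =>
    (hp sec t).trans (eval_nat_mono p (Nat.add_le_add_left ht sec))
  constructor
  · refine hbound.mono fun sec => (L sec).measure_not_le (Q := fun Y => Y.Agreement (τ sec))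
      (hX sec) (hK sec) fun ω A _ hS => A.agreement_of_sound hS ?_
    have h1 := A.gst_le
    have h2 := hTΔ sec
    have h3 : (P sec).timeout ≤ (2 * ((P sec).n * (G sec + 1 + lag sec + τ sec + 1)) + 2) *
      (P sec).timeout := Nat.le_mul_of_pos_left _ (by omega)
    change _ ≤ τ sec + G sec + _
    omega
  · refine hbound.mono fun sec => (L sec).measure_not_le (Q := fun Y => Y.Validity (τ sec))
      (hX sec) (hK sec) fun ω A hC hS => A.validity_of_sound hC hS (hΔ sec) (hTΔ sec)
        (m := G sec + 1) (L := lag sec) ?_ ?_ ?_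
    · exact Nat.lt_succ_of_le A.gst_le
    · exact Nat.add_le_add_right A.gst_le _
    · have h1 := A.gst_le
      change _ ≤ τ sec + G sec + _
      omega
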